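/- Let $\Delta=\{z\in\mathbb C:|z|<1\}$. For $c\in\Delta$ and $0<r<1$ let $$H(c,r)=\Big\{\frac{w+c}{1+\bar c w}:\ |w|=r\Big\}$$ be the hyperbolic circle with hyperbolic center $c$. It is the Euclidean circle with center $e(c,r)=c\,\frac{1-r^2}{1-|c|^2r^2}$ and radius $t(c,r)=r\,\frac{1-|c|^2}{1-|c|^2r^2}$. For $\nu\in\mathbb Z$, a function $E$ on $\Delta$ is said to satisfy condition $(H,c,\nu)$ if for every $r\in(0,1)$ there is a function $F$, continuous on the closed disc $\{|z-e(c,r)|\le t(c,r)\}$ with the point $e(c,r)$ removed, holomorphic in the open disc $\{|z-e(c,r)|<t(c,r)\}$ with the point $e(c,r)$ removed, having at $e(c,r)$ at most a pole of order $\le\max(\nu,0)$ (a removable singularity if $\nu\le 0$), and equal to $E$ on $H(c,r)$. **Theorem.** Let $b_{n,m}\in\mathbb C$ $(n,m\ge 0)$ be such that the double power series $\sum_{n,m=0}^\infty b_{n,m}z^n\bar z^m$ converges (unconditionally) for every $z\in\Delta$, and suppose that its sum $B(z)$ extends to a continuous function on the closed disc $\overline\Delta$. Let $\nu\in\mathbb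 Z$ and suppose that $B$ satisfies conditions $(H,a,\nu)$ and $(H,b,\nu)$ for some two distinct points $a,b\in\Delta$. Then: * if $\nu\ge 0$, $B$ is polyanalytic in $\Delta$ of order at most $\nu$, that is, there are functions $h_0,\dots,h_\nu$ holomorphic in $\Delta$ with $$B(z)=\sum_{k=0}^{\nu}h_k(z)\,\bar z^{\,k}\qquad (z\in\Delta);$$ * if $\nu\le 0$, $B$ is holomorphic in $\Delta$. -/

import Mathlib

open scoped ComplexConjugate

noncomputable section

/-- The hyperbolic circle `H(c, r)` in the unit disc: the image of the circle `‖w‖ = r` under the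
disc automorphism `w ↦ (w + c) / (1 + conj c * w)`. -/
def hyperbolicCircle (c : ℂ) (r : ℝ) : Set ℂ :=
  (fun w : ℂ => (w + c) / (1 + conj c * w)) '' Metric.sphere 0 r

/-- The Euclidean center of the hyperbolic circle `H(c, r)`. -/
def euclideanCenter (c : ℂ) (r : ℝ) : ℂ :=
  c * (((1 - r ^ 2) / (1 - ‖c‖ ^ 2 * r ^ 2) : ℝ) : ℂ)

/-- The Euclidean radius of the hyperbolic circle `H(c, r)`. -/
def euclideanRadius (c : ℂ) (r : ℝ) : ℝ :=
  r * ((1 - ‖c‖ ^ 2) / (1 - ‖c‖ ^ 2 * r ^ 2))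

/-- The condition `(H, a, ν)` for a function `E` in the unit disc: for every `0 < r < 1` the
restriction of `E` to the hyperbolic circle `H(a, r)` extends continuously to the disc bounded by
that circle as a function `F` that is meromorphic there, whose only possible singular point is the
Euclidean center of the circle, and which has there a pole of order at most `max ν 0`. -/
def ConditionH (E : ℂ → ℂ) (a : ℂ) (ν : ℤ) : Prop :=
  ∀ r : ℝ, 0 < r → r < 1 → ∃ F : ℂ → ℂ,
    Set.EqOn F E (hyperbolicCircle a r) ∧
    ContinuousOn F
      (Metric.closedBall (euclideanCenter a r) (euclideanRadius a r) \ {euclideanCenter a r}) ∧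
    DifferentiableOn ℂ F
      (Metric.ball (euclideanCenter a r) (euclideanRadius a r) \ {euclideanCenter a r}) ∧
    MeromorphicAt F (euclideanCenter a r) ∧
    ((-(max ν 0) : ℤ) : WithTop ℤ) ≤ meromorphicOrderAt F (euclideanCenter a r)

/-- `E` is polyanalytic of order at most `N` in the unit disc:
`E z = h₀ z + h₁ z * conj z + ⋯ + h_N z * (conj z) ^ N` with `h₀, …, h_N` holomorphic in the
unit disc. -/
def IsPolyanalyticOfOrderLE (E : ℂ → ℂ) (N : ℕ) : Prop :=
  ∃ h : ℕ → ℂ → ℂ,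
    (∀ k ≤ N, DifferentiableOn ℂ (h k) (Metric.ball 0 1)) ∧
    ∀ z ∈ Metric.ball (0 : ℂ) 1, E z = ∑ k ∈ Finset.range (N + 1), h k z * conj z ^ k

end

theorem hasSum_of_eq {ι : Type*} {f g : ι → ℂ} {a : ℂ} (h : HasSum f a) (e : ∀ i, g i = f i) :
    HasSum g a :=
  (funext e : g = f) ▸ h

/-- The double power series with coefficients `a` converges absolutely in the unit bidisc. -/
def BidiscSummable (a : ℕ → ℕ → ℂ) : Prop :=
  ∀ ρ : ℝ, 0 ≤ ρ → ρ < 1 → Summable fun p : ℕ × ℕ => ‖a p.1 p.2‖ * ρ ^ (p.1 + p.2)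

/-- The sum of the double power series with coefficients `a`. -/
noncomputable def biSeries (a : ℕ → ℕ → ℂ) (x y : ℂ) : ℂ :=
  ∑' p : ℕ × ℕ, a p.1 p.2 * x ^ p.1 * y ^ p.2

theorem norm_biSeries_term_le (a : ℕ → ℕ → ℂ) {x y : ℂ} {ρ : ℝ} (hx : ‖x‖ ≤ ρ) (hy : ‖y‖ ≤ ρ)
    (p : ℕ × ℕ) : ‖a p.1 p.2 * x ^ p.1 * y ^ p.2‖ ≤ ‖a p.1 p.2‖ * ρ ^ (p.1 + p.2) := by
  rw [norm_mul, norm_mul, norm_pow, norm_pow, pow_add, mul_assoc]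
  have : 0 ≤ ρ := (norm_nonneg x).trans hx
  gcongr

theorem BidiscSummable.summable {a : ℕ → ℕ → ℂ} (ha : BidiscSummable a) {x y : ℂ}
    (hx : ‖x‖ < 1) (hy : ‖y‖ < 1) :
    Summable fun p : ℕ × ℕ => a p.1 p.2 * x ^ p.1 * y ^ p.2 :=
  (ha (max ‖x‖ ‖y‖) (le_max_of_le_left (norm_nonneg x)) (max_lt hx hy)).of_norm_bounded
    (norm_biSeries_term_le a (le_max_left _ _) (le_max_right _ _))

theorem BidiscSummable.hasSum {a : ℕ → ℕ → ℂ} (ha : BidiscSummable a) {x y : ℂ}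
    (hx : ‖x‖ < 1) (hy : ‖y‖ < 1) :
    HasSum (fun p : ℕ × ℕ => a p.1 p.2 * x ^ p.1 * y ^ p.2) (biSeries a x y) :=
  (ha.summable hx hy).hasSum

theorem bidiscSummable_of_hasSum {b : ℕ → ℕ → ℂ} {B : ℂ → ℂ}
    (h : ∀ z ∈ Metric.ball (0 : ℂ) 1,
      HasSum (fun p : ℕ × ℕ => b p.1 p.2 * z ^ p.1 * conj z ^ p.2) (B z)) : BidiscSummable b := by
  intro ρ h0 h1
  refine (h (ρ : ℂ) (by simpa [abs_of_nonneg h0] using h1)).summable.norm.congr fun p => ?_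
  simp [abs_of_nonneg h0, pow_add, mul_assoc]

theorem exists_norm_le_lt_one {f : ℂ → ℂ} (hf : DifferentiableOn ℂ f (Metric.ball 0 1))
    (hm : Set.MapsTo f (Metric.ball 0 1) (Metric.ball 0 1)) {r : ℝ} (h0 : 0 ≤ r) (h1 : r < 1) :
    ∃ μ : ℝ, 0 ≤ μ ∧ μ < 1 ∧ ∀ z : ℂ, ‖z‖ ≤ r → ‖f z‖ ≤ μ := by
  have hsub : Metric.closedBall (0 : ℂ) r ⊆ Metric.ball 0 1 := Metric.closedBall_subset_ball h1
  obtain ⟨z, hz, hmax⟩ := (isCompact_closedBall (0 : ℂ) r).exists_isMaxOn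
    ⟨0, by simpa using h0⟩ ((hf.continuousOn.mono hsub).norm)
  refine ⟨‖f z‖, norm_nonneg _, by simpa using hm (hsub hz), fun w hw => ?_⟩
  exact hmax (by simpa using hw : w ∈ Metric.closedBall (0 : ℂ) r)

/-- The `n`-th Taylor coefficient at the origin. -/
noncomputable def taylorCoeff (f : ℂ → ℂ) (n : ℕ) : ℂ := ((n.factorial : ℂ))⁻¹ * iteratedDeriv n f 0

theorem hasSum_taylorCoeff {f : ℂ → ℂ} (hf : DifferentiableOn ℂ f (Metric.ball 0 1)) {z : ℂ}
    (hz : ‖z‖ < 1) : HasSum (fun n => taylorCoeff f n * z ^ n) (f z) :=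
  hasSum_of_eq (Complex.hasSum_taylorSeries_on_ball hf
    (by simpa using hz : z ∈ Metric.ball 0 1)) fun n => by
      simp only [taylorCoeff, sub_zero, smul_eq_mul]
      ring

theorem norm_taylorCoeff_le {f : ℂ → ℂ} (hf : DifferentiableOn ℂ f (Metric.ball 0 1)) {r C : ℝ}
    (h0 : 0 < r) (h1 : r < 1) (hC : ∀ z : ℂ, ‖z‖ ≤ r → ‖f z‖ ≤ C) (n : ℕ) :
    ‖taylorCoeff f n‖ ≤ C / r ^ n := by
  have hd : DiffContOnCl ℂ f (Metric.ball 0 r) := by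
    apply DifferentiableOn.diffContOnCl
    rw [closure_ball _ h0.ne']
    exact hf.mono (Metric.closedBall_subset_ball h1)
  have := Complex.norm_iteratedDeriv_le_of_forall_mem_sphere_norm_le n h0 hd
    (fun z hz => hC z (by simpa using (Metric.sphere_subset_closedBall hz)))
  rw [taylorCoeff, norm_mul, norm_inv, Complex.norm_natCast, inv_mul_le_iff₀ (by positivity)]
  rwa [mul_div_assoc] at this

theorem hasSum_const_mul_prod (c : ℂ) {f g : ℕ → ℂ} {s t : ℂ} (hf : HasSum f s)
    (hg : HasSum g t) : HasSum (fun q : ℕ × ℕ => c * f q.1 * g q.2) (c * s * t) := by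
  have hs : Summable fun q : ℕ × ℕ => f q.1 * g q.2 :=
    summable_mul_of_summable_norm hf.summable.norm hg.summable.norm
  have := (hf.mul hg hs).mul_left c
  simpa only [← mul_assoc] using this

theorem BidiscSummable.exists_comp_of_expansions {b : ℕ → ℕ → ℂ} (hb : BidiscSummable b)
    {f₁ f₂ W : ℂ → ℂ} {α β : ℕ → ℕ → ℂ} (hm₁ : ∀ u, ‖u‖ < 1 → ‖f₁ u‖ < 1)
    (hm₂ : ∀ v, ‖v‖ < 1 → ‖f₂ v‖ < 1)
    (h₁ : ∀ k u, ‖u‖ < 1 → HasSum (fun n => α k n * u ^ n) (f₁ u ^ k))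
    (h₂ : ∀ l v, ‖v‖ < 1 → HasSum (fun m => β l m * v ^ m) (W v * f₂ v ^ l))
    (key : ∀ ρ : ℝ, 0 ≤ ρ → ρ < 1 → Summable fun x : (ℕ × ℕ) × (ℕ × ℕ) =>
      ‖b x.1.1 x.1.2‖ * ‖α x.1.1 x.2.1‖ * ‖β x.1.2 x.2.2‖ * ρ ^ (x.2.1 + x.2.2)) :
    ∃ g : ℕ → ℕ → ℂ, BidiscSummable g ∧ ∀ u v : ℂ, ‖u‖ < 1 → ‖v‖ < 1 →
      biSeries g u v = W v * biSeries b (f₁ u) (f₂ v) := by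
  refine ⟨fun n m => ∑' p : ℕ × ℕ, b p.1 p.2 * α p.1 n * β p.2 m, ?_, ?_⟩
  · intro ρ h0 h1
    have hs := (key ρ h0 h1).prod_symm
    refine hs.prod.of_nonneg_of_le (fun p => by positivity) fun p => ?_
    have hsp := hs.prod_factor p
    simp only [Prod.swap_prod_mk] at hsp ⊢
    rw [tsum_mul_right]
    gcongr
    refine (norm_tsum_le_tsum_norm ?_).trans_eq (by simp only [norm_mul])
    simp only [norm_mul]
    rcases eq_or_lt_of_le h0 with h | h
    · have h2 := ((key (1/2) (by norm_num) (by norm_num)).prod_symm).prod_factor p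
      simp only [Prod.swap_prod_mk] at h2
      exact (summable_mul_right_iff (by positivity)).1 h2
    · exact (summable_mul_right_iff (by positivity)).1 hsp
  · intro u v hu hv
    set ρ := max ‖u‖ ‖v‖
    have hρ0 : 0 ≤ ρ := le_max_of_le_left (norm_nonneg u)
    have hF : Summable fun x : (ℕ × ℕ) × (ℕ × ℕ) =>
        b x.1.1 x.1.2 * (α x.1.1 x.2.1 * u ^ x.2.1) * (β x.1.2 x.2.2 * v ^ x.2.2) := by
      refine (key ρ hρ0 (max_lt hu hv)).of_norm_bounded fun x => ?_
      simp only [norm_mul, norm_pow, pow_add]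
      calc _ = ‖b x.1.1 x.1.2‖ * ‖α x.1.1 x.2.1‖ * ‖β x.1.2 x.2.2‖ *
            (‖u‖ ^ x.2.1 * ‖v‖ ^ x.2.2) := by ring
        _ ≤ _ := by
          gcongr
          · exact le_max_left _ _
          · exact le_max_right _ _
    have hL : ∀ p : ℕ × ℕ, HasSum (fun q : ℕ × ℕ =>
        b p.1 p.2 * (α p.1 q.1 * u ^ q.1) * (β p.2 q.2 * v ^ q.2))
        (b p.1 p.2 * f₁ u ^ p.1 * (W v * f₂ v ^ p.2)) := fun p =>
      hasSum_const_mul_prod (f := fun n => α p.1 n * u ^ n) (g := fun m => β p.2 m * v ^ m)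
        (b p.1 p.2) (h₁ p.1 u hu) (h₂ p.2 v hv)
    have h1 := hF.hasSum.prod_fiberwise hL
    have h2 : HasSum (fun p : ℕ × ℕ => b p.1 p.2 * (f₁ u ^ p.1) * (W v * f₂ v ^ p.2))
        (W v * biSeries b (f₁ u) (f₂ v)) :=
      hasSum_of_eq ((hb.hasSum (hm₁ u hu) (hm₂ v hv)).mul_left (W v)) fun p => by ring
    have h4 : HasSum (fun x : (ℕ × ℕ) × (ℕ × ℕ) =>
        b x.2.1 x.2.2 * (α x.2.1 x.1.1 * u ^ x.1.1) * (β x.2.2 x.1.2 * v ^ x.1.2))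
        (W v * biSeries b (f₁ u) (f₂ v)) := by
      rw [h2.unique h1]
      exact (Equiv.prodComm _ _).hasSum_iff.2 hF.hasSum
    have h5 := h4.prod_fiberwise (fun q => (h4.summable.prod_factor q).hasSum)
    rw [biSeries, ← h5.tsum_eq]
    refine tsum_congr fun q => ?_
    rw [← tsum_mul_right, ← tsum_mul_right]
    refine tsum_congr fun p => ?_
    ring

/-- Composing a double power series converging in the bidisc with holomorphic self-maps of the disc
in each variable, and multiplying by a holomorphic weight, gives again such a series. -/
theorem BidiscSummable.exists_comp {b : ℕ → ℕ → ℂ} (hb : BidiscSummable b) {f₁ f₂ W : ℂ → ℂ}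
    (hf₁ : DifferentiableOn ℂ f₁ (Metric.ball 0 1))
    (hm₁ : Set.MapsTo f₁ (Metric.ball 0 1) (Metric.ball 0 1))
    (hf₂ : DifferentiableOn ℂ f₂ (Metric.ball 0 1))
    (hm₂ : Set.MapsTo f₂ (Metric.ball 0 1) (Metric.ball 0 1))
    (hW : DifferentiableOn ℂ W (Metric.ball 0 1)) :
    ∃ g : ℕ → ℕ → ℂ, BidiscSummable g ∧ ∀ u v : ℂ, ‖u‖ < 1 → ‖v‖ < 1 →
      biSeries g u v = W v * biSeries b (f₁ u) (f₂ v) := by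
  have hd₁ : ∀ k : ℕ, DifferentiableOn ℂ (fun z => f₁ z ^ k) (Metric.ball 0 1) :=
    fun k => hf₁.pow k
  have hd₂ : ∀ l : ℕ, DifferentiableOn ℂ (fun z => W z * f₂ z ^ l) (Metric.ball 0 1) :=
    fun l => hW.mul (hf₂.pow l)
  set α : ℕ → ℕ → ℂ := fun k n => taylorCoeff (fun z => f₁ z ^ k) n with hα
  set β : ℕ → ℕ → ℂ := fun l m => taylorCoeff (fun z => W z * f₂ z ^ l) m with hβ
  have key : ∀ ρ : ℝ, 0 ≤ ρ → ρ < 1 → Summable fun x : (ℕ × ℕ) × (ℕ × ℕ) =>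
      ‖b x.1.1 x.1.2‖ * ‖α x.1.1 x.2.1‖ * ‖β x.1.2 x.2.2‖ * ρ ^ (x.2.1 + x.2.2) := by
    intro ρ h0 h1
    set r : ℝ := (1 + ρ) / 2 with hr
    have hr0 : 0 < r := by rw [hr]; linarith
    have hr1 : r < 1 := by rw [hr]; linarith
    have hρr : ρ / r < 1 := by rw [div_lt_one hr0, hr]; linarith
    have hρr0 : 0 ≤ ρ / r := by positivity
    obtain ⟨μ₁, h₁0, h₁1, h₁⟩ := exists_norm_le_lt_one hf₁ hm₁ hr0.le hr1
    obtain ⟨μ₂, h₂0, h₂1, h₂⟩ := exists_norm_le_lt_one hf₂ hm₂ hr0.le hr1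
    set μ := max μ₁ μ₂ with hμ
    have hμ0 : 0 ≤ μ := le_max_of_le_left h₁0
    obtain ⟨w, hw⟩ := (isCompact_closedBall (0 : ℂ) r).exists_bound_of_continuousOn
      (hW.continuousOn.mono (Metric.closedBall_subset_ball hr1))
    have hw0 : 0 ≤ w := (norm_nonneg _).trans (hw 0 (by simpa using hr0.le))
    have hA : ∀ k n, ‖α k n‖ ≤ μ ^ k / r ^ n := fun k n =>
      norm_taylorCoeff_le (hd₁ k) hr0 hr1 (fun z hz => by
        rw [norm_pow]
        exact pow_le_pow_left₀ (norm_nonneg _) ((h₁ z hz).trans (le_max_left _ _)) k) n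
    have hB : ∀ l m, ‖β l m‖ ≤ w * μ ^ l / r ^ m := fun l m =>
      norm_taylorCoeff_le (hd₂ l) hr0 hr1 (fun z hz => by
        rw [norm_mul, norm_pow]
        exact mul_le_mul (hw z (by simpa using hz))
          (pow_le_pow_left₀ (norm_nonneg _) ((h₂ z hz).trans (le_max_right _ _)) l)
          (by positivity) hw0) m
    have hgeo := summable_geometric_of_lt_one hρr0 hρr
    have hS := ((hb μ hμ0 (max_lt h₁1 h₂1)).mul_left w).mul_of_nonneg
      (hgeo.mul_of_nonneg hgeo (fun n => by positivity) (fun n => by positivity))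
      (fun n => by positivity) (fun n => by positivity)
    refine hS.of_nonneg_of_le (fun x => by positivity) fun x => ?_
    calc ‖b x.1.1 x.1.2‖ * ‖α x.1.1 x.2.1‖ * ‖β x.1.2 x.2.2‖ * ρ ^ (x.2.1 + x.2.2)
        ≤ ‖b x.1.1 x.1.2‖ * (μ ^ x.1.1 / r ^ x.2.1) * (w * μ ^ x.1.2 / r ^ x.2.2)
          * ρ ^ (x.2.1 + x.2.2) := by
          gcongr
          · exact hA _ _
          · exact hB _ _
      _ = _ := by simp only [pow_add, div_pow]; ring
  exact hb.exists_comp_of_expansions (fun u hu => by simpa using hm₁ (by simpa using hu : u ∈ _))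
    (fun v hv => by simpa using hm₂ (by simpa using hv : v ∈ _))
    (fun k u hu => hasSum_taylorCoeff (hd₁ k) hu) (fun l v hv => hasSum_taylorCoeff (hd₂ l) hv) key

theorem circleIntegral_zpow_of_ne {r : ℝ} {n : ℤ} (hn : n ≠ -1) : (∮ z in C(0, r), z ^ n) = 0 := by
  simpa using circleIntegral.integral_sub_zpow_of_ne hn 0 0 r

theorem hasSum_circleIntegral_of_summable {ι : Type*} [Countable ι] {r : ℝ} (hr : 0 ≤ r)
    {F : ι → ℂ → ℂ} {f : ℂ → ℂ} {C : ι → ℝ} (hC : Summable C)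
    (hF : ∀ i, ContinuousOn (F i) (Metric.sphere 0 r))
    (hb : ∀ i, ∀ z ∈ Metric.sphere (0 : ℂ) r, ‖F i z‖ ≤ C i)
    (hs : ∀ z ∈ Metric.sphere (0 : ℂ) r, HasSum (fun i => F i z) (f z)) :
    HasSum (fun i => ∮ z in C(0, r), F i z) (∮ z in C(0, r), f z) := by
  have hmem : ∀ θ, circleMap 0 r θ ∈ Metric.sphere (0 : ℂ) r := circleMap_mem_sphere 0 hr
  unfold circleIntegral
  refine intervalIntegral.hasSum_integral_of_dominated_convergence (fun i _ => r * C i)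
    (fun i => ?_) (fun i => ?_) ?_ ?_ ?_
  · apply Continuous.aestronglyMeasurable
    simp only [deriv_circleMap, smul_eq_mul]
    exact ((continuous_circleMap 0 r).mul continuous_const).mul
      ((hF i).comp_continuous (continuous_circleMap 0 r) hmem)
  · filter_upwards with θ _
    simp only [deriv_circleMap, norm_smul, norm_mul, Complex.norm_I, mul_one, norm_circleMap_zero,
      abs_of_nonneg hr]
    exact mul_le_mul_of_nonneg_left (hb i _ (hmem θ)) hr
  · filter_upwards with θ _ using hC.mul_left r
  · exact intervalIntegrable_const
  · filter_upwards with θ _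
    exact (hs _ (hmem θ)).const_smul _

theorem hasSum_diagonal_eq_zero {a : ℕ → ℕ → ℂ} (ha : BidiscSummable a) {N k : ℕ} {r : ℝ}
    (h0 : 0 < r) (h1 : r < 1) {K : ℂ → ℂ} (hK : DiffContOnCl ℂ K (Metric.ball 0 r))
    (hKa : ∀ w ∈ Metric.sphere (0 : ℂ) r, K w = w ^ N * biSeries a w (conj w)) :
    HasSum (fun n => a n (n + (N + 1 + k)) * ((r : ℂ) ^ 2) ^ (n + (N + 1 + k))) 0 := by
  have hr1 : ∀ z ∈ Metric.sphere (0 : ℂ) r, ‖z‖ = r := fun z hz => by simpa using hz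
  have hne : ∀ z ∈ Metric.sphere (0 : ℂ) r, z ≠ 0 := fun z hz => by
    rw [← norm_pos_iff, hr1 z hz]; exact h0
  have hrc : (r : ℂ) ≠ 0 := by exact_mod_cast h0.ne'
  set F : ℕ × ℕ → ℂ → ℂ := fun p z =>
    (a p.1 p.2 * ((r : ℂ) ^ 2) ^ p.2) * z ^ ((k : ℤ) + N + p.1 - p.2) with hF
  have hFeq : ∀ p, ∀ z ∈ Metric.sphere (0 : ℂ) r,
      F p z = z ^ (k + N) * (a p.1 p.2 * z ^ p.1 * conj z ^ p.2) := by
    intro p z hz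
    have hz0 := hne z hz
    have hc : conj z = (r : ℂ) ^ 2 / z := by
      rw [eq_div_iff hz0, mul_comm, Complex.mul_conj, Complex.normSq_eq_norm_sq, hr1 z hz]
      push_cast; rfl
    have e : z ^ ((k : ℤ) + N + p.1 - p.2) = z ^ (k + N + p.1) / z ^ p.2 := by
      rw [zpow_sub₀ hz0]; norm_cast
    simp only [hF, e, hc, div_pow]
    field_simp
    ring
  have hsum := hasSum_circleIntegral_of_summable h0.le (F := F)
    (f := fun z => z ^ k * K z) (C := fun p => ‖a p.1 p.2‖ * r ^ (p.1 + p.2)) (ha r h0.le h1) ?_ ?_ ?_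
  · have hz : (∮ z in C(0, r), z ^ k * K z) = 0 := by
      apply DiffContOnCl.circleIntegral_eq_zero h0.le
      exact (Differentiable.diffContOnCl (by fun_prop : Differentiable ℂ fun z : ℂ => z ^ k)).smul hK
    rw [hz] at hsum
    have hinj : Function.Injective fun n : ℕ => (n, n + (N + 1 + k)) := fun x y h => by
      simpa using congrArg Prod.fst h
    have hint : ∀ p : ℕ × ℕ, p ∉ Set.range (fun n : ℕ => (n, n + (N + 1 + k))) →
        (∮ z in C(0, r), F p z) = 0 := by
      intro p hp
      simp only [hF]
      rw [circleIntegral.integral_const_mul, circleIntegral_zpow_of_ne, mul_zero]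
      intro he
      exact hp ⟨p.1, Prod.ext rfl (by simp only; omega)⟩
    have h2 := (hinj.hasSum_iff hint).2 hsum
    have h3 := h2.mul_left (2 * Real.pi * Complex.I)⁻¹
    rw [mul_zero] at h3
    refine hasSum_of_eq h3 fun n => ?_
    have e : ((k : ℤ) + N + (n : ℕ) - ((n + (N + 1 + k) : ℕ) : ℤ)) = -1 := by push_cast; ring
    simp only [hF, Function.comp_apply, e]
    rw [circleIntegral.integral_const_mul]
    have := circleIntegral.integral_sub_inv_of_mem_ball (c := 0) (w := 0) (R := r) (by simpa using h0)
    simp only [sub_zero] at this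
    simp only [zpow_neg_one, this]
    field_simp
  · intro p
    apply ContinuousOn.mul continuousOn_const
    exact fun z hz => (continuousAt_zpow₀ z _ (Or.inl (hne z hz))).continuousWithinAt
  · intro p z hz
    rw [hFeq p z hz, norm_mul, norm_pow, hr1 z hz]
    have := norm_biSeries_term_le a (hr1 z hz).le
      (by rw [Complex.norm_conj]; exact (hr1 z hz).le : ‖conj z‖ ≤ r) p
    exact (mul_le_of_le_one_left (norm_nonneg _) (pow_le_one₀ h0.le h1.le)).trans this
  · intro z hz
    have hz1 : ‖z‖ < 1 := (hr1 z hz).trans_lt h1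
    have := (ha.hasSum hz1 (by rwa [Complex.norm_conj] : ‖conj z‖ < 1)).mul_left (z ^ (k + N))
    rw [hKa z hz, ← mul_assoc, ← pow_add]
    exact hasSum_of_eq this fun p => hFeq p z hz

theorem coeff_eq_zero_of_hasSum_zero {c : ℕ → ℂ} {d : ℕ}
    (h : ∀ r : ℝ, 0 < r → r < 1 → HasSum (fun n => c n * ((r : ℂ) ^ 2) ^ (n + d)) 0) (n : ℕ) :
    c n = 0 := by
  have hs : ∀ r : ℝ, 0 < r → r < 1 → HasSum (fun n => c n * ((r : ℂ) ^ 2) ^ n) 0 := by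
    intro r h0 h1
    have hrc : ((r : ℂ) ^ 2) ^ d ≠ 0 := by
      have : (r : ℂ) ≠ 0 := by exact_mod_cast h0.ne'
      positivity
    have := (h r h0 h1).mul_left (((r : ℂ) ^ 2) ^ d)⁻¹
    rw [mul_zero] at this
    refine hasSum_of_eq this fun n => ?_
    rw [pow_add]; field_simp
  set p : FormalMultilinearSeries ℂ ℂ ℂ := FormalMultilinearSeries.ofScalars ℂ c with hp
  have hrad : 0 < p.radius := by
    have h1 := (hs (1/2) (by norm_num) (by norm_num)).summable.norm
    have : ((1 / 4 : NNReal) : ENNReal) ≤ p.radius := by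
      apply p.le_radius_of_summable_norm
      refine h1.of_nonneg_of_le (fun n => by positivity) fun n => ?_
      rw [hp, FormalMultilinearSeries.ofScalars_norm]
      rw [norm_mul, norm_pow]
      gcongr
      norm_num
    exact lt_of_lt_of_le (by norm_num) this
  have hfp := p.hasFPowerSeriesOnBall hrad
  have hzero : ∀ r : ℝ, 0 < r → r < 1 → p.sum ((r : ℂ) ^ 2) = 0 := by
    intro r h0 h1
    rw [← (hs r h0 h1).tsum_eq, FormalMultilinearSeries.sum]
    refine tsum_congr fun n => ?_
    rw [hp, FormalMultilinearSeries.ofScalars_apply_eq, smul_eq_mul]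
  have hev : ∀ᶠ z in nhds (0 : ℂ), p.sum z = 0 := by
    rw [← hfp.analyticAt.frequently_zero_iff_eventually_zero]
    have ht : Filter.Tendsto (fun r : ℝ => (r : ℂ) ^ 2) (nhdsWithin 0 (Set.Ioi 0))
        (nhdsWithin 0 {0}ᶜ) := by
      apply tendsto_nhdsWithin_of_tendsto_nhds_of_eventually_within
      · have : Continuous fun r : ℝ => (r : ℂ) ^ 2 := by fun_prop
        exact (this.tendsto' 0 0 (by simp)).mono_left nhdsWithin_le_nhds
      · filter_upwards [self_mem_nhdsWithin] with r hr
        simpa using ne_of_gt hr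
    apply ht.frequently
    apply Filter.Eventually.frequently
    filter_upwards [Ioo_mem_nhdsGT (zero_lt_one' ℝ)] with r hr using hzero r hr.1 hr.2
  have hp0 : p = 0 := (hfp.hasFPowerSeriesAt.congr hev).eq_zero
  have := FormalMultilinearSeries.coeff_ofScalars (𝕜 := ℂ) (p := c) (n := n)
  rw [← this, ← hp, hp0]
  simp [FormalMultilinearSeries.coeff]

/-- If on every circle `‖w‖ = r` the function `w ^ N * biSeries a w (conj w)` extends
holomorphically to the disc, then the angular frequencies of the series are at least `-N`. -/
theorem coeff_eq_zero_of_forall_extension {a : ℕ → ℕ → ℂ} (ha : BidiscSummable a) {N : ℕ}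
    (h : ∀ r : ℝ, 0 < r → r < 1 → ∃ K : ℂ → ℂ, DiffContOnCl ℂ K (Metric.ball 0 r) ∧
      ∀ w ∈ Metric.sphere (0 : ℂ) r, K w = w ^ N * biSeries a w (conj w))
    {n m : ℕ} (hnm : n + N < m) : a n m = 0 := by
  obtain ⟨k, rfl⟩ : ∃ k, m = n + (N + 1 + k) := ⟨m - (n + N + 1), by omega⟩
  refine coeff_eq_zero_of_hasSum_zero (c := fun n => a n (n + (N + 1 + k))) (d := N + 1 + k)
    (fun r h0 h1 => ?_) n
  obtain ⟨K, hK, hKa⟩ := h r h0 h1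
  exact hasSum_diagonal_eq_zero ha h0 h1 hK hKa

/-- The function `u ^ N * biSeries a u (s / u)`, extended through `u = 0` when the coefficients
`a n m` with `n + N < m` vanish. -/
noncomputable def shear (a : ℕ → ℕ → ℂ) (N : ℕ) (u s : ℂ) : ℂ :=
  ∑' p : ℕ × ℕ, a p.1 p.2 * u ^ (p.1 + N - p.2) * s ^ p.2

section shear

variable {a : ℕ → ℕ → ℂ} {N : ℕ}

theorem norm_shear_term_le (hv : ∀ n m, n + N < m → a n m = 0) {u s : ℂ} {ρ : ℝ} (hρ : ρ ≤ 1)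
    (hu : ‖u‖ ≤ ρ) (hs : ‖s‖ ≤ ρ ^ 2) (p : ℕ × ℕ) :
    ‖a p.1 p.2 * u ^ (p.1 + N - p.2) * s ^ p.2‖ ≤ ‖a p.1 p.2‖ * ρ ^ (p.1 + p.2) := by
  have hρ0 : 0 ≤ ρ := (norm_nonneg u).trans hu
  rcases lt_or_ge (p.1 + N) p.2 with h | h
  · simp [hv _ _ h]
  rw [norm_mul, norm_mul, norm_pow, norm_pow, mul_assoc]
  gcongr
  calc ‖u‖ ^ (p.1 + N - p.2) * ‖s‖ ^ p.2 ≤ ρ ^ (p.1 + N - p.2) * (ρ ^ 2) ^ p.2 := by gcongr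
    _ = ρ ^ (p.1 + p.2 + N) := by
      rw [← pow_mul, ← pow_add]; congr 1; omega
    _ ≤ ρ ^ (p.1 + p.2) := pow_le_pow_of_le_one hρ0 hρ (by omega)

theorem exists_shear_radius {u s : ℂ} (hu : ‖u‖ < 1) (hs : ‖s‖ < 1) :
    ∃ ρ : ℝ, 0 ≤ ρ ∧ ρ < 1 ∧ ‖u‖ < ρ ∧ ‖s‖ < ρ ^ 2 := by
  have h : max ‖u‖ (Real.sqrt ‖s‖) < 1 :=
    max_lt hu ((Real.sqrt_lt_sqrt (norm_nonneg s) hs).trans_eq Real.sqrt_one)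
  obtain ⟨ρ, h1, h2⟩ := exists_between h
  have hρ0 : 0 ≤ ρ := (norm_nonneg u).trans ((le_max_left _ _).trans h1.le)
  exact ⟨ρ, hρ0, h2, (le_max_left _ _).trans_lt h1,
    (Real.sqrt_lt' (lt_of_le_of_lt (Real.sqrt_nonneg _) ((le_max_right _ _).trans_lt h1))).1
      ((le_max_right _ _).trans_lt h1)⟩

theorem differentiableOn_shear_left (ha : BidiscSummable a) (hv : ∀ n m, n + N < m → a n m = 0)
    {s : ℂ} (hs : ‖s‖ < 1) : DifferentiableOn ℂ (fun u => shear a N u s) (Metric.ball 0 1) := by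
  intro u hu
  obtain ⟨ρ, h0, h1, h2, h3⟩ := exists_shear_radius (by simpa using hu) hs
  have : DifferentiableOn ℂ (fun u => shear a N u s) (Metric.ball 0 ρ) :=
    Complex.differentiableOn_tsum_of_summable_norm (ha ρ h0 h1) (fun p => by fun_prop)
      Metric.isOpen_ball fun p w hw =>
        norm_shear_term_le hv h1.le (by simpa using (Metric.mem_ball.1 hw).le) h3.le p
  exact (this.differentiableAt (Metric.isOpen_ball.mem_nhds (by simpa using h2))).differentiableWithinAt

theorem differentiableOn_shear_right (ha : BidiscSummable a) (hv : ∀ n m, n + N < m → a n m = 0)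
    {u : ℂ} (hu : ‖u‖ < 1) : DifferentiableOn ℂ (fun s => shear a N u s) (Metric.ball 0 1) := by
  intro s hs
  obtain ⟨ρ, h0, h1, h2, h3⟩ := exists_shear_radius hu (by simpa using hs)
  have : DifferentiableOn ℂ (fun s => shear a N u s) (Metric.ball 0 (ρ ^ 2)) :=
    Complex.differentiableOn_tsum_of_summable_norm (ha ρ h0 h1) (fun p => by fun_prop)
      Metric.isOpen_ball fun p w hw =>
        norm_shear_term_le hv h1.le h2.le (by simpa using (Metric.mem_ball.1 hw).le) p
  exact (this.differentiableAt (Metric.isOpen_ball.mem_nhds (by simpa using h3))).differentiableWithinAt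

theorem shear_eq (hv : ∀ n m, n + N < m → a n m = 0) {u s : ℂ} (hu : u ≠ 0) :
    shear a N u s = u ^ N * biSeries a u (s / u) := by
  rw [shear, biSeries, ← tsum_mul_left]
  refine tsum_congr fun p => ?_
  rcases lt_or_ge (p.1 + N) p.2 with h | h
  · simp [hv _ _ h]
  rw [pow_sub₀ u hu h, div_pow, pow_add]
  field_simp

theorem norm_shear_le (ha : BidiscSummable a) (hv : ∀ n m, n + N < m → a n m = 0) {C : ℝ}
    (hC : ∀ u : ℂ, ‖u‖ < 1 → ‖biSeries a u (conj u)‖ ≤ C) {r : ℝ} (h0 : 0 < r) (h1 : r < 1)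
    {u : ℂ} (hu : ‖u‖ ≤ r) : ‖shear a N u ((r : ℂ) ^ 2)‖ ≤ C := by
  have hs : ‖(r : ℂ) ^ 2‖ < 1 := by
    rw [norm_pow, Complex.norm_real, Real.norm_of_nonneg h0.le]
    exact pow_lt_one₀ h0.le h1 two_ne_zero
  refine Complex.norm_le_of_forall_mem_frontier_norm_le (U := Metric.ball (0 : ℂ) r)
    (f := fun u => shear a N u ((r : ℂ) ^ 2)) Metric.isBounded_ball ?_ (fun z hz => ?_) ?_
  · apply DifferentiableOn.diffContOnCl
    rw [closure_ball _ h0.ne']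
    exact (differentiableOn_shear_left ha hv hs).mono (Metric.closedBall_subset_ball h1)
  · rw [frontier_ball _ h0.ne', mem_sphere_zero_iff_norm] at hz
    have hz0 : z ≠ 0 := by rw [← norm_pos_iff, hz]; exact h0
    have hc : (r : ℂ) ^ 2 / z = conj z := by
      rw [div_eq_iff hz0, mul_comm, Complex.mul_conj, Complex.normSq_eq_norm_sq, hz]
      push_cast; rfl
    have hz1 : ‖z‖ < 1 := hz.trans_lt h1
    rw [shear_eq hv hz0, hc, norm_mul, norm_pow]
    exact (mul_le_of_le_one_left (norm_nonneg _) (pow_le_one₀ (norm_nonneg _) hz1.le)).trans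
      (hC z hz1)
  · rw [closure_ball _ h0.ne']; simpa using hu

end shear

section extended

variable {a : ℕ → ℕ → ℂ} {N : ℕ}

theorem norm_biSeries_term_le_of_vanish (hv : ∀ n m, n + N < m → a n m = 0) {Y : ℝ} (hY : 1 ≤ Y)
    {x y : ℂ} (hx : ‖x‖ ≤ 1 / (4 * Y)) (hy : ‖y‖ ≤ Y) (p : ℕ × ℕ) :
    ‖a p.1 p.2 * x ^ p.1 * y ^ p.2‖ ≤
      (2 * Y) ^ N * (‖a p.1 p.2‖ * (1 / 2) ^ (p.1 + p.2)) := by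
  rcases lt_or_ge (p.1 + N) p.2 with h | h
  · simp [hv _ _ h]
  rw [norm_mul, norm_mul, norm_pow, norm_pow]
  have hY0 : 0 < Y := by linarith
  calc ‖a p.1 p.2‖ * ‖x‖ ^ p.1 * ‖y‖ ^ p.2
      ≤ ‖a p.1 p.2‖ * (1 / (4 * Y)) ^ p.1 * Y ^ p.2 := by gcongr
    _ = ‖a p.1 p.2‖ * (1 / (4 * Y)) ^ p.1 * ((2 * Y) ^ p.2 * (1 / 2) ^ p.2) := by
      rw [← mul_pow]; congr 2; ring
    _ ≤ ‖a p.1 p.2‖ * (1 / (4 * Y)) ^ p.1 * ((2 * Y) ^ (p.1 + N) * (1 / 2) ^ p.2) := by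
      gcongr
      linarith
    _ = (2 * Y) ^ N * (‖a p.1 p.2‖ * ((1 / (4 * Y) * (2 * Y)) ^ p.1 * (1 / 2) ^ p.2)) := by
      rw [mul_pow (1 / (4 * Y)), pow_add (2 * Y)]; generalize 2 * Y = T; ring
    _ = _ := by
      rw [pow_add]; congr 4; field_simp; norm_num

theorem summable_of_vanish (ha : BidiscSummable a) (hv : ∀ n m, n + N < m → a n m = 0) {Y : ℝ}
    (hY : 1 ≤ Y) {x y : ℂ} (hx : ‖x‖ ≤ 1 / (4 * Y)) (hy : ‖y‖ ≤ Y) :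
    Summable fun p : ℕ × ℕ => a p.1 p.2 * x ^ p.1 * y ^ p.2 :=
  ((ha (1 / 2) (by norm_num) (by norm_num)).mul_left ((2 * Y) ^ N)).of_norm_bounded
    (norm_biSeries_term_le_of_vanish hv hY hx hy)

theorem exists_norm_biSeries_le (ha : BidiscSummable a) (hv : ∀ n m, n + N < m → a n m = 0)
    {Y : ℝ} (hY : 1 ≤ Y) :
    ∃ C : ℝ, ∀ x y : ℂ, ‖x‖ ≤ 1 / (4 * Y) → ‖y‖ ≤ Y → ‖biSeries a x y‖ ≤ C :=
  ⟨_, fun _ _ hx hy => tsum_of_norm_bounded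
    ((ha (1 / 2) (by norm_num) (by norm_num)).mul_left ((2 * Y) ^ N)).hasSum
    (norm_biSeries_term_le_of_vanish hv hY hx hy)⟩

theorem differentiableOn_biSeries_right (ha : BidiscSummable a)
    (hv : ∀ n m, n + N < m → a n m = 0) {Y : ℝ} (hY : 1 ≤ Y) {x : ℂ}
    (hx : ‖x‖ ≤ 1 / (4 * Y)) :
    DifferentiableOn ℂ (fun y => biSeries a x y) (Metric.ball 0 Y) :=
  Complex.differentiableOn_tsum_of_summable_norm
    ((ha (1 / 2) (by norm_num) (by norm_num)).mul_left ((2 * Y) ^ N)) (fun p => by fun_prop)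
    Metric.isOpen_ball fun p w hw =>
      norm_biSeries_term_le_of_vanish hv hY hx (by simpa using (Metric.mem_ball.1 hw).le) p

theorem BidiscSummable.shift (ha : BidiscSummable a) (J : ℕ) :
    BidiscSummable fun n m => a (n + J) m := by
  intro ρ h0 h1
  set σ : ℝ := max ρ (1 / 2)
  have hσ0 : 0 < σ := lt_max_of_lt_right (by norm_num)
  have hinj : Function.Injective fun p : ℕ × ℕ => (p.1 + J, p.2) := fun p q h => by
    simp only [Prod.mk.injEq, add_left_inj] at h
    exact Prod.ext h.1 h.2
  have h2 := ((ha σ hσ0.le (max_lt h1 (by norm_num))).comp_injective hinj).mul_left (σ ^ J)⁻¹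
  refine h2.of_nonneg_of_le (fun p => by positivity) fun p => ?_
  simp only [Function.comp_apply]
  calc ‖a (p.1 + J) p.2‖ * ρ ^ (p.1 + p.2) ≤ ‖a (p.1 + J) p.2‖ * σ ^ (p.1 + p.2) := by
        gcongr; exact le_max_left _ _
    _ = _ := by
        rw [show p.1 + J + p.2 = (p.1 + p.2) + J by ring, pow_add σ (p.1 + p.2) J]; field_simp

theorem tsum_prod_eq_zero_add {f : ℕ × ℕ → ℂ} (hf : Summable f) :
    ∑' p, f p = ∑' m, f (0, m) + ∑' p : ℕ × ℕ, f (p.1 + 1, p.2) := by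
  have hinj : Function.Injective fun p : ℕ × ℕ => (p.1 + 1, p.2) := fun p q h => by
    simp only [Prod.mk.injEq, add_left_inj] at h
    exact Prod.ext h.1 h.2
  have hf1 : Summable fun p : ℕ × ℕ => f (p.1 + 1, p.2) := hf.comp_injective hinj
  rw [hf.tsum_prod, hf.prod.tsum_eq_zero_add, hf1.tsum_prod]

theorem biSeries_eq_add_shift_one (hv : ∀ n m, n + N < m → a n m = 0) {x y : ℂ}
    (hs : Summable fun p : ℕ × ℕ => a p.1 p.2 * x ^ p.1 * y ^ p.2) :
    biSeries a x y = ∑ m ∈ Finset.range (N + 1), a 0 m * y ^ m +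
      x * biSeries (fun n m => a (n + 1) m) x y := by
  have h1 : x * biSeries (fun n m => a (n + 1) m) x y =
      ∑' p : ℕ × ℕ, a (p.1 + 1) p.2 * x ^ (p.1 + 1) * y ^ p.2 := by
    rw [biSeries, ← tsum_mul_left]
    exact tsum_congr fun p => by ring
  have h2 : ∑' m, a 0 m * x ^ 0 * y ^ m = ∑ m ∈ Finset.range (N + 1), a 0 m * y ^ m := by
    rw [tsum_eq_sum (s := Finset.range (N + 1))]
    · simp
    · intro m hm
      rw [Finset.mem_range, not_lt] at hm
      simp [hv 0 m (by omega)]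
  rw [h1, ← h2]
  exact tsum_prod_eq_zero_add hs

theorem biSeries_eq_add_shift (ha : BidiscSummable a) (hv : ∀ n m, n + N < m → a n m = 0) {Y : ℝ}
    (hY : 1 ≤ Y) {x y : ℂ} (hx : ‖x‖ ≤ 1 / (4 * Y)) (hy : ‖y‖ ≤ Y) (J : ℕ) :
    biSeries a x y = ∑ j ∈ Finset.range J,
        x ^ j * ∑ m ∈ Finset.range (N + j + 1), a j m * y ^ m +
      x ^ J * biSeries (fun n m => a (n + J) m) x y := by
  induction J with
  | zero => simp
  | succ J ih =>
    have hvJ : ∀ n m, n + (N + J) < m → a (n + J) m = 0 := fun n m h => hv _ _ (by omega)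
    rw [ih, Finset.sum_range_succ, biSeries_eq_add_shift_one hvJ
      (summable_of_vanish (ha.shift J) hvJ hY hx hy)]
    have : (fun n m => a (n + 1 + J) m) = fun n m => a (n + (J + 1)) m := by
      funext n m; rw [add_right_comm, add_assoc]
    simp only [this, zero_add]
    ring

end extended

/-- A higher order Schwarz lemma: the leading coefficient at a zero of order `J` of a holomorphic
function bounded by `C` on the disc of radius `ρ` is at most `C / ρ ^ J`. -/
theorem norm_leading_coeff_le {ρ : ℝ} (hρ : 0 < ρ) {J : ℕ} : ∀ {f K : ℂ → ℂ} {k : ℂ} {C : ℝ},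
    DifferentiableOn ℂ f (Metric.ball 0 ρ) → (∀ x ∈ Metric.ball (0 : ℂ) ρ, ‖f x‖ ≤ C) →
    (∀ᶠ x in nhdsWithin (0 : ℂ) {0}ᶜ, f x = x ^ J * K x) →
    Filter.Tendsto K (nhdsWithin 0 {0}ᶜ) (nhds k) → ‖k‖ ≤ C / ρ ^ J := by
  induction J with
  | zero =>
    intro f K k C hf hC hfK hK
    have h1 : Filter.Tendsto f (nhdsWithin 0 {0}ᶜ) (nhds k) :=
      hK.congr' (hfK.mono fun x hx => by rw [hx]; simp)
    rw [pow_zero, div_one]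
    refine le_of_tendsto h1.norm ?_
    filter_upwards [nhdsWithin_le_nhds (Metric.ball_mem_nhds (0 : ℂ) hρ)] with x hx using hC x hx
  | succ J ih =>
    intro f K k C hf hC hfK hK
    have hnhds : Metric.ball (0 : ℂ) ρ ∈ nhds 0 := Metric.ball_mem_nhds 0 hρ
    have hf0 : f 0 = 0 := by
      have h1 : Filter.Tendsto f (nhdsWithin 0 {0}ᶜ) (nhds (f 0)) :=
        ((hf.differentiableAt hnhds).continuousAt.tendsto).mono_left nhdsWithin_le_nhds
      have h2 : Filter.Tendsto (fun x : ℂ => x ^ (J + 1)) (nhdsWithin 0 {0}ᶜ) (nhds 0) :=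
        ((continuous_pow (J + 1)).tendsto' 0 0 (by simp)).mono_left nhdsWithin_le_nhds
      have h3 := (h2.mul hK).congr' (hfK.mono fun x hx => hx.symm)
      rw [zero_mul] at h3
      exact tendsto_nhds_unique h1 h3
    have h := ih (f := dslope f 0) (K := K) (k := k) (C := C / ρ)
      ((Complex.differentiableOn_dslope hnhds).2 hf)
      (fun x hx => Complex.norm_dslope_le_div_of_mapsTo_ball hf
        (fun z hz => by simpa [hf0] using hC z hz) hx) ?_ hK
    · rwa [div_div, ← pow_succ'] at h
    · filter_upwards [hfK, self_mem_nhdsWithin] with x hx hx0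
      have hx0' : x ≠ 0 := hx0
      rw [dslope_of_ne _ hx0', slope_def_field, hf0, hx]
      field_simp
      ring

/-- The disc automorphism moving the origin to `c`. -/
noncomputable def discAut (c w : ℂ) : ℂ := (w + c) / (1 + conj c * w)

theorem one_add_mul_ne_zero {c w : ℂ} (hc : ‖c‖ < 1) (hw : ‖w‖ < 1) : 1 + c * w ≠ 0 := by
  intro h
  have h1 : ‖c * w‖ = 1 := by
    rw [show c * w = -1 by linear_combination h]; simp
  rw [norm_mul] at h1
  nlinarith [norm_nonneg c, norm_nonneg w]

theorem one_add_conj_mul_ne_zero {c w : ℂ} (hc : ‖c‖ < 1) (hw : ‖w‖ < 1) :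
    1 + conj c * w ≠ 0 :=
  one_add_mul_ne_zero (by rwa [Complex.norm_conj]) hw

theorem norm_discAut_lt_one {c w : ℂ} (hc : ‖c‖ < 1) (hw : ‖w‖ < 1) : ‖discAut c w‖ < 1 := by
  have h := one_add_conj_mul_ne_zero hc hw
  rw [discAut, norm_div, div_lt_one (norm_pos_iff.2 h), ← sq_lt_sq₀ (norm_nonneg _) (norm_nonneg _)]
  have hc2 : ‖c‖ ^ 2 < 1 := pow_lt_one₀ (norm_nonneg _) hc two_ne_zero
  have hw2 : ‖w‖ ^ 2 < 1 := pow_lt_one₀ (norm_nonneg _) hw two_ne_zero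
  rw [Complex.sq_norm, Complex.normSq_apply] at *
  rw [Complex.sq_norm, Complex.normSq_apply] at *
  simp only [Complex.add_re, Complex.add_im, Complex.mul_re, Complex.mul_im, Complex.conj_re,
    Complex.conj_im, Complex.one_re, Complex.one_im]
  nlinarith [mul_pos (sub_pos.2 hc2) (sub_pos.2 hw2)]

theorem mapsTo_discAut {c : ℂ} (hc : ‖c‖ < 1) :
    Set.MapsTo (discAut c) (Metric.ball 0 1) (Metric.ball 0 1) := fun w hw => by
  simpa using norm_discAut_lt_one hc (by simpa using hw)

theorem differentiableOn_discAut {c : ℂ} (hc : ‖c‖ < 1) :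
    DifferentiableOn ℂ (discAut c) (Metric.ball 0 1) := by
  intro w hw
  have h := one_add_conj_mul_ne_zero hc (by simpa using hw : ‖w‖ < 1)
  unfold discAut
  fun_prop (disch := assumption)

theorem conj_discAut (c w : ℂ) : conj (discAut c w) = discAut (conj c) (conj w) := by
  simp [discAut]

theorem one_sub_norm_sq_ne_zero {c : ℂ} (hc : ‖c‖ < 1) : 1 - conj c * c ≠ 0 := by
  have := one_add_conj_mul_ne_zero (c := -c) (w := c) (by rwa [norm_neg]) hc
  simpa [sub_eq_add_neg] using this

theorem discAut_discAut_neg {c z : ℂ} (hc : ‖c‖ < 1) (hz : ‖z‖ < 1) :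
    discAut c (discAut (-c) z) = z := by
  have h1 : 1 + conj (-c) * z ≠ 0 := one_add_conj_mul_ne_zero (by rwa [norm_neg]) hz
  have h3 := one_sub_norm_sq_ne_zero hc
  have h2 := one_add_conj_mul_ne_zero hc (norm_discAut_lt_one (c := -c) (by rwa [norm_neg]) hz)
  rw [discAut, div_eq_iff h2, discAut]
  rw [map_neg] at h1 ⊢
  generalize conj c = d at *
  rw [← mul_left_inj' h1, add_mul, mul_assoc, add_mul, div_mul_cancel₀ _ h1, one_mul, mul_assoc d,
    div_mul_cancel₀ _ h1]
  ring

theorem conj_mul_self_eq (c : ℂ) : conj c * c = ((‖c‖ ^ 2 : ℝ) : ℂ) := by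
  rw [Complex.conj_mul']; push_cast; rfl

section circle

variable {c : ℂ} {r : ℝ}

theorem one_sub_norm_sq_mul_pos (hc : ‖c‖ < 1) (h0 : 0 < r) (h1 : r < 1) :
    0 < 1 - ‖c‖ ^ 2 * r ^ 2 := by
  have hc2 : ‖c‖ ^ 2 < 1 := pow_lt_one₀ (norm_nonneg _) hc two_ne_zero
  have hr2 : r ^ 2 < 1 := pow_lt_one₀ h0.le h1 two_ne_zero
  nlinarith [sq_nonneg ‖c‖]

theorem euclideanRadius_pos (hc : ‖c‖ < 1) (h0 : 0 < r) (h1 : r < 1) :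
    0 < euclideanRadius c r := by
  have hc2 : ‖c‖ ^ 2 < 1 := pow_lt_one₀ (norm_nonneg _) hc two_ne_zero
  exact mul_pos h0 (div_pos (by linarith) (one_sub_norm_sq_mul_pos hc h0 h1))

theorem discAut_sub_euclideanCenter (hc : ‖c‖ < 1) (h0 : 0 < r) (h1 : r < 1) {w : ℂ}
    (hw : ‖w‖ < 1) : discAut c w - euclideanCenter c r =
      ((euclideanRadius c r / r : ℝ) : ℂ) * (w + c * r ^ 2) / (1 + conj c * w) := by
  have h := one_add_conj_mul_ne_zero hc hw
  have hd : (1 : ℂ) - conj c * c * r ^ 2 ≠ 0 := by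
    rw [conj_mul_self_eq]
    exact_mod_cast (one_sub_norm_sq_mul_pos hc h0 h1).ne'
  have hr : (r : ℂ) ≠ 0 := by exact_mod_cast h0.ne'
  have e1 : ((euclideanRadius c r / r : ℝ) : ℂ) = (1 - conj c * c) / (1 - conj c * c * r ^ 2) := by
    rw [conj_mul_self_eq, euclideanRadius, mul_div_cancel_left₀ _ h0.ne']
    push_cast; rfl
  have e2 : euclideanCenter c r = c * ((1 - r ^ 2) / (1 - conj c * c * r ^ 2)) := by
    rw [conj_mul_self_eq, euclideanCenter]; push_cast; rfl
  rw [e1, e2, discAut]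
  generalize conj c = d at *
  rw [← mul_div_assoc, div_sub_div _ _ h hd, div_mul_eq_mul_div, div_div, div_eq_div_iff
    (mul_ne_zero h hd) (mul_ne_zero hd h)]
  ring

theorem norm_add_sq_sub (w : ℂ) : r ^ 2 * ‖1 + conj c * w‖ ^ 2 - ‖w + c * r ^ 2‖ ^ 2 =
    (r ^ 2 - ‖w‖ ^ 2) * (1 - ‖c‖ ^ 2 * r ^ 2) := by
  simp only [Complex.sq_norm, Complex.normSq_apply, ← Complex.ofReal_pow,
    Complex.add_re, Complex.add_im, Complex.mul_re, Complex.mul_im, Complex.conj_re,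
    Complex.conj_im, Complex.one_re, Complex.one_im, Complex.ofReal_re, Complex.ofReal_im]
  ring

theorem mapsTo_discAut_ball (hc : ‖c‖ < 1) (h0 : 0 < r) (h1 : r < 1) :
    Set.MapsTo (discAut c) (Metric.ball 0 r)
      (Metric.ball (euclideanCenter c r) (euclideanRadius c r)) := by
  intro w hw
  have hwr : ‖w‖ < r := by simpa using hw
  have hw1 : ‖w‖ < 1 := hwr.trans h1
  have hpos := norm_pos_iff.2 (one_add_conj_mul_ne_zero hc hw1)
  have ht := euclideanRadius_pos hc h0 h1
  rw [Metric.mem_ball, dist_eq_norm, discAut_sub_euclideanCenter hc h0 h1 hw1, norm_div, norm_mul,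
    Complex.norm_real, Real.norm_of_nonneg (by positivity), div_lt_iff₀ hpos, div_mul_eq_mul_div,
    div_lt_iff₀ h0, mul_assoc]
  gcongr
  rw [← sq_lt_sq₀ (norm_nonneg _) (by positivity), mul_pow]
  have h := norm_add_sq_sub (c := c) (r := r) w
  have h2 : ‖w‖ ^ 2 < r ^ 2 := by gcongr
  nlinarith [mul_pos (sub_pos.2 h2) (one_sub_norm_sq_mul_pos hc h0 h1)]

end circle

theorem diffContOnCl_update {F : ℂ → ℂ} {e l : ℂ} {t : ℝ} (ht : 0 < t)
    (hc : ContinuousOn F (Metric.closedBall e t \ {e}))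
    (hd : DifferentiableOn ℂ F (Metric.ball e t \ {e}))
    (hl : Filter.Tendsto F (nhdsWithin e {e}ᶜ) (nhds l)) :
    DiffContOnCl ℂ (Function.update F e l) (Metric.ball e t) := by
  have hat : ContinuousAt (Function.update F e l) e := continuousAt_update_same.2 hl
  have heq : ∀ z, z ≠ e → Function.update F e l z = F z := fun z hz => by simp [hz]
  constructor
  · rw [← Complex.differentiableOn_compl_singleton_and_continuousAt_iff (Metric.ball_mem_nhds e ht)]
    exact ⟨hd.congr fun z hz => heq z hz.2, hat⟩
  · rw [closure_ball _ ht.ne']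
    intro z hz
    rcases eq_or_ne z e with rfl | hze
    · exact hat.continuousWithinAt
    · have h1 : ContinuousOn (Function.update F e l) (Metric.closedBall e t \ {e}) :=
        hc.congr fun z hz => heq z hz.2
      refine (h1 z ⟨hz, hze⟩).mono_of_mem_nhdsWithin ?_
      exact Filter.inter_mem self_mem_nhdsWithin
        (mem_nhdsWithin_of_mem_nhds (isOpen_compl_singleton.mem_nhds hze))

theorem exists_tendsto_pow_mul {F : ℂ → ℂ} {e : ℂ} (hF : MeromorphicAt F e) {N : ℕ}
    (ho : ((-(N : ℤ) : ℤ) : WithTop ℤ) ≤ meromorphicOrderAt F e) :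
    ∃ l, Filter.Tendsto (fun z => (z - e) ^ N * F z) (nhdsWithin e {e}ᶜ) (nhds l) := by
  have hm : MeromorphicAt (fun z : ℂ => (z - e) ^ N) e := by fun_prop
  apply tendsto_nhds_of_meromorphicOrderAt_nonneg (hm.mul hF)
  have h1 : meromorphicOrderAt (fun z : ℂ => (z - e) ^ N) e = ((N : ℤ) : WithTop ℤ) := by
    rw [meromorphicOrderAt_eq_int_iff hm]
    exact ⟨fun _ => 1, analyticAt_const, one_ne_zero, by simp⟩
  rw [meromorphicOrderAt_mul hm hF, h1]
  calc (0 : WithTop ℤ) = ((N : ℤ) : WithTop ℤ) + ((-(N : ℤ) : ℤ) : WithTop ℤ) := by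
        rw [← WithTop.coe_add]; simp
    _ ≤ _ := by gcongr

/-- In the hyperbolic coordinate centred at `c`, condition `(H, c, ν)` says that the weighted
function `(1 + c * conj w) ^ N * B` has angular frequencies at least `-N` on each circle. -/
theorem ConditionH.exists_extension {B : ℂ → ℂ} {c : ℂ} {ν : ℤ} (hH : ConditionH B c ν)
    (hc : ‖c‖ < 1) {r : ℝ} (h0 : 0 < r) (h1 : r < 1) :
    ∃ K : ℂ → ℂ, DiffContOnCl ℂ K (Metric.ball 0 r) ∧ ∀ w ∈ Metric.sphere (0 : ℂ) r,
      K w = w ^ ν.toNat * ((1 + c * conj w) ^ ν.toNat * B (discAut c w)) := by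
  obtain ⟨F, hFE, hFc, hFd, hFm, hFo⟩ := hH r h0 h1
  rw [← Int.toNat_eq_max] at hFo
  set N := ν.toNat
  set e := euclideanCenter c r with he
  set t := euclideanRadius c r with ht
  have htpos : 0 < t := euclideanRadius_pos hc h0 h1
  obtain ⟨l, hl⟩ := exists_tendsto_pow_mul hFm hFo
  have hF2 := diffContOnCl_update htpos
    ((by fun_prop : ContinuousOn (fun z : ℂ => (z - e) ^ N) _).mul hFc)
    ((by fun_prop : DifferentiableOn ℂ (fun z : ℂ => (z - e) ^ N) _).mul hFd) hl
  have hm : DiffContOnCl ℂ (discAut c) (Metric.ball 0 r) := by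
    apply DifferentiableOn.diffContOnCl
    rw [closure_ball _ h0.ne']
    exact (differentiableOn_discAut hc).mono (Metric.closedBall_subset_ball h1)
  have htr : ((t / r : ℝ) : ℂ) ≠ 0 := by exact_mod_cast (div_pos htpos h0).ne'
  refine ⟨fun w => ((1 + conj c * w) / ((t / r : ℝ) : ℂ)) ^ N *
    Function.update (fun z => (z - e) ^ N * F z) e l (discAut c w), ?_, ?_⟩
  · have h3 : Differentiable ℂ fun w => ((1 + conj c * w) / ((t / r : ℝ) : ℂ)) ^ N := by fun_prop
    exact h3.diffContOnCl.smul (hF2.comp hm (mapsTo_discAut_ball hc h0 h1))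
  · intro w hw
    have hwr : ‖w‖ = r := by simpa using hw
    have hw1 : ‖w‖ < 1 := hwr.trans_lt h1
    have hw0 : w ≠ 0 := by rw [← norm_pos_iff, hwr]; exact h0
    have hne := one_add_conj_mul_ne_zero hc hw1
    have hne' : 1 + c * conj w ≠ 0 := one_add_mul_ne_zero hc (by rwa [Complex.norm_conj])
    have hd : w + c * r ^ 2 = w * (1 + c * conj w) := by
      have := conj_mul_self_eq w
      rw [hwr] at this
      push_cast at this
      linear_combination (-c) * this
    have hsub := discAut_sub_euclideanCenter hc h0 h1 hw1
    rw [hd, ← he, ← ht] at hsub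
    have hwe : discAut c w ≠ e := by
      rw [← sub_ne_zero, hsub]
      exact div_ne_zero (mul_ne_zero htr (mul_ne_zero hw0 hne')) hne
    have hFB : F (discAut c w) = B (discAut c w) := hFE ⟨w, hw, rfl⟩
    simp only [Function.update_of_ne hwe, hFB, hsub]
    have key : (1 + conj c * w) / ((t / r : ℝ) : ℂ) *
        (((t / r : ℝ) : ℂ) * (w * (1 + c * conj w)) / (1 + conj c * w)) =
        w * (1 + c * conj w) := by
      rw [div_mul_div_comm, mul_left_comm, mul_div_mul_left _ _ htr, mul_div_cancel_left₀ _ hne]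
    rw [← mul_assoc (w ^ N), ← mul_pow w]
    conv_rhs => rw [← key, mul_pow, mul_assoc]

/-- The angular expansion of the weighted function `(1 + c * conj w) ^ N * B` around `c`. -/
theorem ConditionH.exists_series {b : ℕ → ℕ → ℂ} {B : ℂ → ℂ}
    (hseries : ∀ z ∈ Metric.ball (0 : ℂ) 1,
      HasSum (fun p : ℕ × ℕ => b p.1 p.2 * z ^ p.1 * conj z ^ p.2) (B z))
    {c : ℂ} {ν : ℤ} (hH : ConditionH B c ν) (hc : ‖c‖ < 1) :
    ∃ g : ℕ → ℕ → ℂ, BidiscSummable g ∧ (∀ n m, n + ν.toNat < m → g n m = 0) ∧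
      (∀ u v : ℂ, ‖u‖ < 1 → ‖v‖ < 1 → biSeries g u v =
        (1 + c * v) ^ ν.toNat * biSeries b (discAut c u) (discAut (conj c) v)) ∧
      ∀ w : ℂ, ‖w‖ < 1 →
        biSeries g w (conj w) = (1 + c * conj w) ^ ν.toNat * B (discAut c w) := by
  have hb := bidiscSummable_of_hasSum hseries
  have hc' : ‖conj c‖ < 1 := by rwa [Complex.norm_conj]
  obtain ⟨g, hg, hgb⟩ := hb.exists_comp (differentiableOn_discAut hc) (mapsTo_discAut hc)
    (differentiableOn_discAut hc') (mapsTo_discAut hc')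
    (W := fun v => (1 + c * v) ^ ν.toNat) (by fun_prop)
  have hB : ∀ w : ℂ, ‖w‖ < 1 →
      biSeries g w (conj w) = (1 + c * conj w) ^ ν.toNat * B (discAut c w) := by
    intro w hw
    rw [hgb w (conj w) hw (by rwa [Complex.norm_conj]), ← conj_discAut, biSeries,
      (hseries (discAut c w) (by simpa using norm_discAut_lt_one hc hw)).tsum_eq]
  refine ⟨g, hg, fun n m hnm => ?_, hgb, hB⟩
  refine coeff_eq_zero_of_forall_extension hg (fun r h0 h1 => ?_) hnm
  obtain ⟨K, hK, hKw⟩ := hH.exists_extension hc h0 h1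
  refine ⟨K, hK, fun w hw => ?_⟩
  rw [hKw w hw, hB w ((by simpa using hw : ‖w‖ = r).trans_lt h1)]

/-- Numerator of `discAut (-p) ∘ discAut q`. -/
noncomputable def trNum (p q x : ℂ) : ℂ := (1 - p * conj q) * x + (q - p)

/-- Denominator of `discAut (-p) ∘ discAut q`. -/
noncomputable def trDen (p q x : ℂ) : ℂ := (1 - conj p * q) + (conj q - conj p) * x

/-- The complexified circle `u * v = s` around `p`, in the coordinate `x` around `q` with
`u = trNum p q x / trDen p q x`: numerator of the conjugate coordinate around `q`. -/
noncomputable def circNum (p q x s : ℂ) : ℂ :=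
  (1 - p * conj q) * s * trDen p q x - (conj q - conj p) * trNum p q x

/-- The denominator belonging to `circNum`. -/
noncomputable def circDen (p q x s : ℂ) : ℂ :=
  (1 - conj p * q) * trNum p q x - (q - p) * s * trDen p q x

section transition

variable {p q : ℂ}

theorem one_sub_conj_mul_ne_zero (hp : ‖p‖ < 1) (hq : ‖q‖ < 1) : 1 - conj p * q ≠ 0 := by
  have := one_add_conj_mul_ne_zero (c := -p) (w := q) (by rwa [norm_neg]) hq
  simpa [sub_eq_add_neg] using this

theorem trDen_eq {x : ℂ} (hq : ‖q‖ < 1) (hx : ‖x‖ < 1) :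
    trDen p q x = (1 + conj q * x) * (1 + conj (-p) * discAut q x) := by
  have h := one_add_conj_mul_ne_zero hq hx
  have e : (1 + conj q * x) * discAut q x = x + q := mul_div_cancel₀ _ h
  rw [trDen, map_neg]
  linear_combination conj p * e

theorem trDen_ne_zero {x : ℂ} (hp : ‖p‖ < 1) (hq : ‖q‖ < 1) (hx : ‖x‖ < 1) :
    trDen p q x ≠ 0 := by
  rw [trDen_eq hq hx]
  exact mul_ne_zero (one_add_conj_mul_ne_zero hq hx)
    (one_add_conj_mul_ne_zero (by rwa [norm_neg]) (norm_discAut_lt_one hq hx))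

theorem trNum_div_trDen {x : ℂ} (hq : ‖q‖ < 1) (hx : ‖x‖ < 1) :
    trNum p q x / trDen p q x = discAut (-p) (discAut q x) := by
  have h := one_add_conj_mul_ne_zero hq hx
  have e : (1 + conj q * x) * discAut q x = x + q := mul_div_cancel₀ _ h
  rw [trDen_eq hq hx, discAut.eq_1 (-p), ← mul_div_mul_left (discAut q x + -p) _ h]
  congr 1
  rw [trNum]
  linear_combination -e

theorem norm_tr_lt_one {x : ℂ} (hp : ‖p‖ < 1) (hq : ‖q‖ < 1) (hx : ‖x‖ < 1) :
    ‖trNum p q x / trDen p q x‖ < 1 := by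
  rw [trNum_div_trDen hq hx]
  exact norm_discAut_lt_one (by rwa [norm_neg]) (norm_discAut_lt_one hq hx)

theorem differentiableOn_tr (hp : ‖p‖ < 1) (hq : ‖q‖ < 1) :
    DifferentiableOn ℂ (fun x => trNum p q x / trDen p q x) (Metric.ball 0 1) := by
  intro x hx
  have h := trDen_ne_zero hp hq (by simpa using hx : ‖x‖ < 1)
  unfold trNum
  unfold trDen at *
  fun_prop (disch := assumption)

/-- The comparison of the expansions around `p` and around `q`, on the complexified circles around
`p`. -/
theorem shear_eq_biSeries_of_lt {b g h : ℕ → ℕ → ℂ} {N : ℕ} (hp : ‖p‖ < 1) (hq : ‖q‖ < 1)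
    (hvg : ∀ n m, n + N < m → g n m = 0)
    (hgb : ∀ u v : ℂ, ‖u‖ < 1 → ‖v‖ < 1 → biSeries g u v =
      (1 + p * v) ^ N * biSeries b (discAut p u) (discAut (conj p) v))
    (hhb : ∀ u v : ℂ, ‖u‖ < 1 → ‖v‖ < 1 → biSeries h u v =
      (1 + q * v) ^ N * biSeries b (discAut q u) (discAut (conj q) v))
    {x s : ℂ} (hx : ‖x‖ < 1) (hs : ‖s‖ < ‖trNum p q x / trDen p q x‖) :
    ((1 - conj q * q) * trDen p q x) ^ N * shear g N (trNum p q x / trDen p q x) s =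
      circDen p q x s ^ N * biSeries h x (circNum p q x s / circDen p q x s) := by
  set A := trNum p q x with hA
  set D := trDen p q x with hD
  have hD0 : D ≠ 0 := trDen_ne_zero hp hq hx
  have hu1 : ‖A / D‖ < 1 := norm_tr_lt_one hp hq hx
  have hu0 : A / D ≠ 0 := norm_pos_iff.1 ((norm_nonneg s).trans_lt hs)
  have hA0 : A ≠ 0 := (div_ne_zero_iff.1 hu0).1
  set v := s / (A / D) with hv
  have hv1 : ‖v‖ < 1 := by
    rw [hv, norm_div, div_lt_one (norm_pos_iff.2 hu0)]; exact hs
  have hAv : A * v = s * D := by rw [hv]; field_simp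
  have hpc : ‖conj p‖ < 1 := by rwa [Complex.norm_conj]
  have hqc : ‖conj q‖ < 1 := by rwa [Complex.norm_conj]
  set w := discAut (conj p) v with hw
  have hw1 : ‖w‖ < 1 := norm_discAut_lt_one hpc hv1
  have hpv : 1 + p * v ≠ 0 := one_add_mul_ne_zero hp hv1
  have hwe : (1 + p * v) * w = v + conj p := by
    rw [hw, discAut, Complex.conj_conj]; exact mul_div_cancel₀ _ hpv
  have hqw : 1 + (-q) * w ≠ 0 := one_add_mul_ne_zero (by rwa [norm_neg]) hw1
  set y := discAut (-conj q) w with hy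
  have hy1 : ‖y‖ < 1 := norm_discAut_lt_one (by rwa [norm_neg]) hw1
  have hye : (1 + (-q) * w) * y = w - conj q := by
    rw [hy, discAut, map_neg, Complex.conj_conj, ← sub_eq_add_neg w]; exact mul_div_cancel₀ _ hqw
  have hL : circDen p q x s = A * ((1 + p * v) * (1 + (-q) * w)) := by
    rw [circDen, ← hA, ← hD]
    linear_combination (q - p) * hAv + q * A * hwe
  have hL0 : circDen p q x s ≠ 0 := by
    rw [hL]; exact mul_ne_zero hA0 (mul_ne_zero hpv hqw)
  have hM : circNum p q x s / circDen p q x s = y := by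
    rw [div_eq_iff hL0, hL, circNum, ← hA, ← hD]
    linear_combination (-(1 - p * conj q)) * hAv - A * hwe - A * (1 + p * v) * hye
  have hz : discAut p (A / D) = discAut q x := by
    rw [trNum_div_trDen hq hx, discAut_discAut_neg hp (norm_discAut_lt_one hq hx)]
  have hyw : discAut (conj q) y = w := discAut_discAut_neg hqc hw1
  rw [hM, shear_eq hvg hu0, ← hv, hgb _ _ hu1 hv1, hhb _ _ hx hy1, hz, hyw, ← mul_assoc,
    ← mul_assoc, ← mul_assoc, ← mul_pow, ← mul_pow, ← mul_pow]
  congr 2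
  have hDu : D * (A / D) = A := mul_div_cancel₀ _ hD0
  have hLM : circDen p q x s * y = circNum p q x s := by
    rw [← hM, mul_div_cancel₀ _ hL0]
  rw [circDen, circNum, ← hA, ← hD] at hLM
  rw [circDen, ← hA, ← hD]
  linear_combination (1 - conj q * q) * (1 + p * v) * hDu - q * hLM +
    ((1 - conj q * q) * p) * hAv

end transition

/-- If `L → 0` and `M` has a nonzero limit, then boundedness of
`L ^ N * ∑ m < T, c m * (M / L) ^ m` forces the coefficients of degree above `N` to vanish. -/
theorem coeff_eq_zero_of_bounded {ι : Type*} {l : Filter ι} [l.NeBot] {L M : ι → ℂ} {μ : ℂ}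
    (hL : Filter.Tendsto L l (nhds 0)) (hL0 : ∀ᶠ i in l, L i ≠ 0)
    (hM : Filter.Tendsto M l (nhds μ)) (hμ : μ ≠ 0) {N : ℕ} {c : ℕ → ℂ} {C : ℝ} (T : ℕ)
    (hb : ∀ᶠ i in l, ‖L i ^ N * ∑ m ∈ Finset.range T, c m * (M i / L i) ^ m‖ ≤ C) :
    ∀ m, N < m → m < T → c m = 0 := by
  induction T with
  | zero => intro m _ h; omega
  | succ T ih =>
    rcases le_or_gt T N with hTN | hTN
    · intro m h1 h2; omega
    have hcT : c T = 0 := by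
      have h1 : Filter.Tendsto (fun i => ∑ m ∈ Finset.range (T + 1), c m * M i ^ m * L i ^ (T - m))
          l (nhds (∑ m ∈ Finset.range (T + 1), c m * μ ^ m * 0 ^ (T - m))) :=
        tendsto_finsetSum _ fun m _ => ((hM.pow m).const_mul (c m)).mul (hL.pow (T - m))
      have h2 : ∑ m ∈ Finset.range (T + 1), c m * μ ^ m * 0 ^ (T - m) = c T * μ ^ T := by
        rw [Finset.sum_range_succ, Finset.sum_eq_zero]
        · simp
        · intro m hm
          rw [zero_pow (by have := Finset.mem_range.1 hm; omega), mul_zero]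
      have h3 : Filter.Tendsto (fun i => L i ^ (T - N) *
          (L i ^ N * ∑ m ∈ Finset.range (T + 1), c m * (M i / L i) ^ m)) l (nhds 0) := by
        have hz : Filter.Tendsto (fun i => L i ^ (T - N)) l (nhds 0) := by
          have := hL.pow (T - N)
          rwa [zero_pow (by omega)] at this
        exact hz.zero_mul_isBoundedUnder_le ⟨C, Filter.eventually_map.2 hb⟩
      have h4 := tendsto_nhds_unique_of_eventuallyEq h1 h3 <| by
        filter_upwards [hL0] with i hi
        rw [← mul_assoc, ← pow_add, Nat.sub_add_cancel hTN.le, Finset.mul_sum]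
        refine Finset.sum_congr rfl fun m hm => ?_
        have hm' : m ≤ T := by have := Finset.mem_range.1 hm; omega
        rw [div_pow, pow_sub₀ _ hi hm']
        field_simp
      rw [h2] at h4
      exact (mul_eq_zero.1 h4).resolve_right (pow_ne_zero _ hμ)
    intro m h1 h2
    rcases Nat.lt_succ_iff_lt_or_eq.1 h2 with h | rfl
    · exact ih (by simpa [Finset.sum_range_succ, hcT] using hb) m h1 h
    · exact hcT

section transition

variable {p q : ℂ}

theorem continuous_circNum : Continuous fun z : ℂ × ℂ => circNum p q z.1 z.2 := by
  unfold circNum trDen trNum; fun_prop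

theorem continuous_circDen : Continuous fun z : ℂ × ℂ => circDen p q z.1 z.2 := by
  unfold circDen trDen trNum; fun_prop

theorem circDen_zero (s : ℂ) : circDen p q 0 s = (1 - conj p * q) * (q - p) * (1 - s) := by
  unfold circDen trDen trNum; ring

theorem circNum_zero (s : ℂ) : circNum p q 0 s =
    (1 - p * conj q) * (1 - conj p * q) * s - (conj q - conj p) * (q - p) := by
  unfold circNum trDen trNum; ring

theorem circDen_zero_ne_zero (hp : ‖p‖ < 1) (hq : ‖q‖ < 1) (hpq : p ≠ q) {s : ℂ} (hs : ‖s‖ < 1) :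
    circDen p q 0 s ≠ 0 := by
  rw [circDen_zero]
  refine mul_ne_zero (mul_ne_zero (one_sub_conj_mul_ne_zero hp hq) (sub_ne_zero.2 hpq.symm)) ?_
  intro h
  rw [← sub_eq_zero.1 h] at hs
  simp at hs

theorem differentiable_circNum (x : ℂ) : Differentiable ℂ fun s => circNum p q x s := by
  unfold circNum; fun_prop

theorem differentiable_circDen (x : ℂ) : Differentiable ℂ fun s => circDen p q x s := by
  unfold circDen; fun_prop

theorem eventually_circ_bound (hp : ‖p‖ < 1) (hq : ‖q‖ < 1) (hpq : p ≠ q) {σ : ℝ} (hσ : σ < 1) :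
    ∃ Y : ℝ, 1 ≤ Y ∧ ∀ᶠ x in nhds (0 : ℂ), ∀ s ∈ Metric.closedBall (0 : ℂ) σ,
      circDen p q x s ≠ 0 ∧ ‖circNum p q x s / circDen p q x s‖ < Y := by
  have hne : ∀ s ∈ Metric.closedBall (0 : ℂ) σ, circDen p q 0 s ≠ 0 := fun s hs =>
    circDen_zero_ne_zero hp hq hpq ((by simpa using hs : ‖s‖ ≤ σ).trans_lt hσ)
  obtain ⟨C, hC⟩ := (isCompact_closedBall (0 : ℂ) σ).exists_bound_of_continuousOn
    (f := fun s => circNum p q 0 s / circDen p q 0 s)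
    ((differentiable_circNum 0).continuous.continuousOn.div
      (differentiable_circDen 0).continuous.continuousOn hne)
  refine ⟨max 1 C + 1, by linarith [le_max_left 1 C], ?_⟩
  apply (isCompact_closedBall (0 : ℂ) σ).eventually_forall_of_forall_eventually
  intro s hs
  have h0 : ContinuousAt (fun z : ℂ × ℂ => circDen p q z.1 z.2) (0, s) :=
    continuous_circDen.continuousAt
  have h1 : ContinuousAt (fun z : ℂ × ℂ => circNum p q z.1 z.2 / circDen p q z.1 z.2) (0, s) :=
    continuous_circNum.continuousAt.div h0 (hne s hs)
  refine (h0.eventually_ne (hne s hs)).and (h1.norm.eventually_lt_const ?_)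
  exact (hC s hs).trans_lt ((le_max_right 1 C).trans_lt (lt_add_one _))

variable {b g h : ℕ → ℕ → ℂ} {N : ℕ}

/-- The comparison of the two expansions continues analytically to all complexified circles
around `p`, near the coordinate `x = 0`. -/
theorem eventually_shear_eq_biSeries (hp : ‖p‖ < 1) (hq : ‖q‖ < 1) (hpq : p ≠ q)
    (hg : BidiscSummable g) (hh : BidiscSummable h)
    (hvg : ∀ n m, n + N < m → g n m = 0) (hvh : ∀ n m, n + N < m → h n m = 0)
    (hgb : ∀ u v : ℂ, ‖u‖ < 1 → ‖v‖ < 1 → biSeries g u v =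
      (1 + p * v) ^ N * biSeries b (discAut p u) (discAut (conj p) v))
    (hhb : ∀ u v : ℂ, ‖u‖ < 1 → ‖v‖ < 1 → biSeries h u v =
      (1 + q * v) ^ N * biSeries b (discAut q u) (discAut (conj q) v))
    {s : ℂ} (hs : ‖s‖ < 1) :
    ∃ Y : ℝ, 1 ≤ Y ∧ ∀ᶠ x in nhds (0 : ℂ), circDen p q x s ≠ 0 ∧
      ‖circNum p q x s / circDen p q x s‖ < Y ∧
      ((1 - conj q * q) * trDen p q x) ^ N * shear g N (trNum p q x / trDen p q x) s =
        circDen p q x s ^ N * biSeries h x (circNum p q x s / circDen p q x s) := by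
  obtain ⟨σ, hsσ, hσ⟩ := exists_between hs
  have hσ0 : 0 < σ := (norm_nonneg s).trans_lt hsσ
  obtain ⟨Y, hY, hYx⟩ := eventually_circ_bound hp hq hpq hσ
  refine ⟨Y, hY, ?_⟩
  have h0 : trNum p q 0 / trDen p q 0 ≠ 0 := by
    refine div_ne_zero ?_ (trDen_ne_zero hp hq (by simp))
    simpa [trNum] using sub_ne_zero.2 hpq.symm
  obtain ⟨ε, hε0, hε⟩ := exists_between (norm_pos_iff.2 h0)
  have hεx : ∀ᶠ x in nhds (0 : ℂ), ε < ‖trNum p q x / trDen p q x‖ :=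
    (((differentiableOn_tr hp hq).differentiableAt
      (Metric.ball_mem_nhds 0 one_pos)).continuousAt.norm).eventually_const_lt hε
  have hx1 : ∀ᶠ x in nhds (0 : ℂ), ‖x‖ < 1 := by
    filter_upwards [Metric.ball_mem_nhds (0 : ℂ) one_pos] with x hx using by simpa using hx
  have hxY : ∀ᶠ x in nhds (0 : ℂ), ‖x‖ < 1 / (4 * Y) := by
    filter_upwards [Metric.ball_mem_nhds (0 : ℂ) (by positivity : 0 < 1 / (4 * Y))] with x hx
      using by simpa only [mem_ball_zero_iff] using hx
  filter_upwards [hYx, hεx, hx1, hxY] with x hY' hε' hx1 hxY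
  have hsm : s ∈ Metric.ball (0 : ℂ) σ := by simpa using hsσ
  obtain ⟨hd, hlt⟩ := hY' s (Metric.ball_subset_closedBall hsm)
  refine ⟨hd, hlt, ?_⟩
  have hd1 : DifferentiableOn ℂ (fun s => ((1 - conj q * q) * trDen p q x) ^ N *
      shear g N (trNum p q x / trDen p q x) s) (Metric.ball 0 σ) :=
    ((differentiableOn_shear_right hg hvg (norm_tr_lt_one hp hq hx1)).mono
      (Metric.ball_subset_ball hσ.le)).const_mul _
  have hd2 : DifferentiableOn ℂ (fun s => circDen p q x s ^ N *
      biSeries h x (circNum p q x s / circDen p q x s)) (Metric.ball 0 σ) := by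
    refine ((differentiable_circDen x).differentiableOn.pow N).mul ?_
    refine (differentiableOn_biSeries_right hh hvh hY hxY.le).comp
      ((differentiable_circNum x).differentiableOn.div (differentiable_circDen x).differentiableOn
        fun t ht => (hY' t (Metric.ball_subset_closedBall ht)).1) fun t ht => ?_
    simpa using (hY' t (Metric.ball_subset_closedBall ht)).2
  refine (hd1.analyticOnNhd Metric.isOpen_ball).eqOn_of_preconnected_of_eventuallyEq
    (hd2.analyticOnNhd Metric.isOpen_ball) (convex_ball _ _).isPreconnected
    (Metric.mem_ball_self hσ0) ?_ hsm
  filter_upwards [Metric.ball_mem_nhds (0 : ℂ) hε0] with t ht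
  exact shear_eq_biSeries_of_lt hp hq hvg hgb hhb hx1
    ((by simpa using ht : ‖t‖ < ε).trans hε')

/-- The part of the expansion around `q` of order less than `J` in `x`, as a polynomial. -/
noncomputable def lowPart (p q : ℂ) (h : ℕ → ℕ → ℂ) (N J : ℕ) (x s : ℂ) : ℂ :=
  ∑ j ∈ Finset.range J, x ^ j * ∑ m ∈ Finset.range (N + 1),
    h j m * (circNum p q x s ^ m * circDen p q x s ^ (N - m))

theorem continuous_lowPart (J : ℕ) : Continuous fun z : ℂ × ℂ => lowPart p q h N J z.1 z.2 := by
  unfold lowPart circNum circDen trNum trDen; fun_prop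

theorem differentiable_lowPart (J : ℕ) (s : ℂ) :
    Differentiable ℂ fun x => lowPart p q h N J x s := by
  unfold lowPart circNum circDen trNum trDen; fun_prop

theorem circDen_pow_mul_biSeries {J : ℕ} (hh : BidiscSummable h)
    (hvh : ∀ n m, n + N < m → h n m = 0) (hJ : ∀ j < J, ∀ m, N < m → h j m = 0)
    {Y : ℝ} (hY : 1 ≤ Y) {x s : ℂ} (hx : ‖x‖ ≤ 1 / (4 * Y)) (hd : circDen p q x s ≠ 0)
    (hy : ‖circNum p q x s / circDen p q x s‖ ≤ Y) :
    circDen p q x s ^ N * biSeries h x (circNum p q x s / circDen p q x s) =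
      lowPart p q h N J x s + x ^ J * (circDen p q x s ^ N *
        biSeries (fun n m => h (n + J) m) x (circNum p q x s / circDen p q x s)) := by
  rw [biSeries_eq_add_shift hh hvh hY hx hy J, mul_add, mul_left_comm _ (x ^ J), lowPart,
    Finset.mul_sum]
  congr 1
  refine Finset.sum_congr rfl fun j hj => ?_
  rw [mul_left_comm]
  congr 1
  rw [← Finset.sum_subset (Finset.range_subset_range.2 (by omega : N + 1 ≤ N + j + 1)), Finset.mul_sum]
  · refine Finset.sum_congr rfl fun m hm => ?_
    have hm' : m ≤ N := by have := Finset.mem_range.1 hm; omega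
    rw [div_pow, pow_sub₀ _ hd hm']
    field_simp
  · intro m _ hm
    rw [hJ j (Finset.mem_range.1 hj) m (by simpa using hm), zero_mul]

theorem tendsto_biSeries_shift {J : ℕ} (hh : BidiscSummable h)
    (hvh : ∀ n m, n + N < m → h n m = 0) {Y : ℝ} (hY : 1 ≤ Y) {y : ℂ → ℂ}
    (hy : ContinuousAt y 0) (hyY : ∀ᶠ x in nhds (0 : ℂ), ‖y x‖ ≤ Y) :
    Filter.Tendsto (fun x => biSeries (fun n m => h (n + J) m) x (y x)) (nhds 0)
      (nhds (∑ m ∈ Finset.range (N + J + 1), h J m * y 0 ^ m)) := by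
  have hvJ : ∀ n m, n + (N + J) < m → h (n + J) m = 0 := fun n m h => hvh _ _ (by omega)
  have hvJ1 : ∀ n m, n + (N + J + 1) < m → h (n + 1 + J) m = 0 := fun n m h => hvh _ _ (by omega)
  obtain ⟨C, hC⟩ := exists_norm_biSeries_le ((hh.shift J).shift 1) hvJ1 hY
  have hxY : ∀ᶠ x in nhds (0 : ℂ), ‖x‖ < 1 / (4 * Y) := by
    filter_upwards [Metric.ball_mem_nhds (0 : ℂ) (by positivity : 0 < 1 / (4 * Y))] with x hx
      using by simpa only [mem_ball_zero_iff] using hx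
  have h1 : Filter.Tendsto (fun x => ∑ m ∈ Finset.range (N + J + 1), h J m * y x ^ m) (nhds 0)
      (nhds (∑ m ∈ Finset.range (N + J + 1), h J m * y 0 ^ m)) :=
    tendsto_finsetSum _ fun m _ => (hy.tendsto.pow m).const_mul _
  have h2 : Filter.Tendsto (fun x => x * biSeries (fun n m => h (n + 1 + J) m) x (y x)) (nhds 0)
      (nhds 0) := by
    refine Filter.Tendsto.zero_mul_isBoundedUnder_le Filter.tendsto_id ⟨C, ?_⟩
    rw [Filter.eventually_map]
    filter_upwards [hxY, hyY] with x hx hyx using hC x (y x) hx.le hyx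
  have h3 := h1.add h2
  rw [add_zero] at h3
  refine h3.congr' ?_
  filter_upwards [hxY, hyY] with x hx hyx
  rw [biSeries_eq_add_shift_one hvJ (summable_of_vanish (hh.shift J) hvJ hY hx.le hyx)]
  simp

end transition

section descent

variable {p q : ℂ} {b g h : ℕ → ℕ → ℂ} {N : ℕ}

theorem exists_leading_bound (hp : ‖p‖ < 1) (hq : ‖q‖ < 1) (hpq : p ≠ q)
    (hg : BidiscSummable g) (hh : BidiscSummable h)
    (hvg : ∀ n m, n + N < m → g n m = 0) (hvh : ∀ n m, n + N < m → h n m = 0)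
    (hgb : ∀ u v : ℂ, ‖u‖ < 1 → ‖v‖ < 1 → biSeries g u v =
      (1 + p * v) ^ N * biSeries b (discAut p u) (discAut (conj p) v))
    (hhb : ∀ u v : ℂ, ‖u‖ < 1 → ‖v‖ < 1 → biSeries h u v =
      (1 + q * v) ^ N * biSeries b (discAut q u) (discAut (conj q) v))
    {C : ℝ} (hC : ∀ u : ℂ, ‖u‖ < 1 → ‖biSeries g u (conj u)‖ ≤ C)
    {J : ℕ} (hJ : ∀ j < J, ∀ m, N < m → h j m = 0) :
    ∃ C' ρ : ℝ, 0 ≤ ρ ∧ ρ < 1 ∧ ∀ r : ℝ, ρ < r → r < 1 →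
      ‖circDen p q 0 ((r : ℂ) ^ 2) ^ N * ∑ m ∈ Finset.range (N + J + 1),
        h J m * (circNum p q 0 ((r : ℂ) ^ 2) / circDen p q 0 ((r : ℂ) ^ 2)) ^ m‖ ≤ C' := by
  obtain ⟨ρ, hρ0, hρ1, hρ⟩ := exists_norm_le_lt_one (differentiableOn_tr hp hq)
    (fun x hx => by simpa using norm_tr_lt_one hp hq (by simpa using hx : ‖x‖ < 1))
    (by norm_num : (0 : ℝ) ≤ 1 / 2) (by norm_num)
  obtain ⟨P, hP⟩ := ((isCompact_closedBall (0 : ℂ) 1).prod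
    (isCompact_closedBall (0 : ℂ) 1)).exists_bound_of_continuousOn
      (continuous_lowPart (p := p) (q := q) (h := h) (N := N) J).continuousOn
  have hDc : Differentiable ℂ fun x => ((1 - conj q * q) * trDen p q x) ^ N := by
    unfold trDen; fun_prop
  obtain ⟨D, hD⟩ := (isCompact_closedBall (0 : ℂ) 1).exists_bound_of_continuousOn
    hDc.continuous.continuousOn
  have hD0 : 0 ≤ D := (norm_nonneg _).trans (hD 0 (by simp))
  refine ⟨(D * C + P) / (1 / 2) ^ J, ρ, hρ0, hρ1, fun r hr h1 => ?_⟩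
  have h0 : 0 < r := hρ0.trans_lt hr
  set s : ℂ := (r : ℂ) ^ 2 with hs
  have hs1 : ‖s‖ < 1 := by
    rw [hs, norm_pow, Complex.norm_real, Real.norm_of_nonneg h0.le]
    exact pow_lt_one₀ h0.le h1 two_ne_zero
  obtain ⟨Y, hY, hYx⟩ := eventually_shear_eq_biSeries hp hq hpq hg hh hvg hvh hgb hhb hs1
  have hne := circDen_zero_ne_zero hp hq hpq hs1
  have hcn : ContinuousAt (fun x => circNum p q x s) 0 :=
    (continuous_circNum.comp (by fun_prop : Continuous fun x : ℂ => (x, s))).continuousAt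
  have hcd : ContinuousAt (fun x => circDen p q x s) 0 :=
    (continuous_circDen.comp (by fun_prop : Continuous fun x : ℂ => (x, s))).continuousAt
  have hxY : ∀ᶠ x in nhds (0 : ℂ), ‖x‖ < 1 / (4 * Y) := by
    filter_upwards [Metric.ball_mem_nhds (0 : ℂ) (by positivity : 0 < 1 / (4 * Y))] with x hx
      using by simpa only [mem_ball_zero_iff] using hx
  have hlim := (hcd.tendsto.pow N).mul (tendsto_biSeries_shift (J := J) hh hvh hY
    (hcn.div hcd hne) (hYx.mono fun x hx => hx.2.1.le))
  refine norm_leading_coeff_le (ρ := 1 / 2) (by norm_num)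
    (f := fun x => ((1 - conj q * q) * trDen p q x) ^ N *
      shear g N (trNum p q x / trDen p q x) s - lowPart p q h N J x s) ?_ ?_ ?_
    (hlim.mono_left nhdsWithin_le_nhds)
  · refine (hDc.differentiableOn.mul ?_).sub (differentiable_lowPart J s).differentiableOn
    exact (differentiableOn_shear_left hg hvg hs1).comp
      ((differentiableOn_tr hp hq).mono (Metric.ball_subset_ball (by norm_num)))
      fun x hx => by
        have : ‖x‖ < 1 / 2 := by simpa only [mem_ball_zero_iff] using hx
        simpa using norm_tr_lt_one hp hq (this.trans (by norm_num))
  · intro x hx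
    have hx2 : ‖x‖ < 1 / 2 := by simpa only [mem_ball_zero_iff] using hx
    have hx1 : x ∈ Metric.closedBall (0 : ℂ) 1 := by
      simpa using hx2.le.trans (by norm_num : (1 / 2 : ℝ) ≤ 1)
    refine (norm_sub_le _ _).trans (add_le_add ?_ (hP (x, s) ⟨hx1, by simpa using hs1.le⟩))
    rw [norm_mul]
    exact mul_le_mul (hD x hx1) (norm_shear_le hg hvg hC h0 h1 ((hρ x hx2.le).trans hr.le))
      (norm_nonneg _) hD0
  · filter_upwards [nhdsWithin_le_nhds hYx, nhdsWithin_le_nhds hxY] with x hx hxY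
    rw [hx.2.2, circDen_pow_mul_biSeries hh hvh hJ hY hxY.le hx.1 hx.2.1.le, add_sub_cancel_left]
    rfl

theorem coeff_eq_zero_of_two_points (hp : ‖p‖ < 1) (hq : ‖q‖ < 1) (hpq : p ≠ q)
    (hg : BidiscSummable g) (hh : BidiscSummable h)
    (hvg : ∀ n m, n + N < m → g n m = 0) (hvh : ∀ n m, n + N < m → h n m = 0)
    (hgb : ∀ u v : ℂ, ‖u‖ < 1 → ‖v‖ < 1 → biSeries g u v =
      (1 + p * v) ^ N * biSeries b (discAut p u) (discAut (conj p) v))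
    (hhb : ∀ u v : ℂ, ‖u‖ < 1 → ‖v‖ < 1 → biSeries h u v =
      (1 + q * v) ^ N * biSeries b (discAut q u) (discAut (conj q) v))
    {C : ℝ} (hC : ∀ u : ℂ, ‖u‖ < 1 → ‖biSeries g u (conj u)‖ ≤ C) (J : ℕ) :
    ∀ m, N < m → h J m = 0 := by
  induction J using Nat.strong_induction_on with
  | _ J ih =>
    intro m hm
    rcases lt_or_ge (J + N) m with hmJ | hmJ
    · exact hvh J m hmJ
    obtain ⟨C', ρ, hρ0, hρ1, hb⟩ :=
      exists_leading_bound hp hq hpq hg hh hvg hvh hgb hhb hC (J := J) ih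
    have hmem : Set.Ioo ρ 1 ∈ nhdsWithin (1 : ℝ) (Set.Iio 1) := Ioo_mem_nhdsLT hρ1
    have hsq : Filter.Tendsto (fun r : ℝ => (r : ℂ) ^ 2) (nhdsWithin 1 (Set.Iio 1)) (nhds 1) :=
      ((by fun_prop : Continuous fun r : ℝ => (r : ℂ) ^ 2).tendsto' 1 1 (by simp)).mono_left
        nhdsWithin_le_nhds
    refine coeff_eq_zero_of_bounded (l := nhdsWithin (1 : ℝ) (Set.Iio 1))
      (L := fun r => circDen p q 0 ((r : ℂ) ^ 2)) (M := fun r => circNum p q 0 ((r : ℂ) ^ 2))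
      (μ := (1 - conj p * p) * (1 - conj q * q)) (C := C') (c := h J) ?_ ?_ ?_
      (mul_ne_zero (one_sub_norm_sq_ne_zero hp) (one_sub_norm_sq_ne_zero hq)) (N + J + 1) ?_ m hm
      (by omega)
    · have := ((differentiable_circDen (p := p) (q := q) 0).continuous.tendsto 1).comp hsq
      rwa [show circDen p q 0 1 = 0 by rw [circDen_zero]; ring] at this
    · filter_upwards [hmem] with r hr
      apply circDen_zero_ne_zero hp hq hpq
      rw [norm_pow, Complex.norm_real, Real.norm_of_nonneg (hρ0.trans hr.1.le)]
      exact pow_lt_one₀ (hρ0.trans hr.1.le) hr.2 two_ne_zero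
    · have := ((differentiable_circNum (p := p) (q := q) 0).continuous.tendsto 1).comp hsq
      rwa [show circNum p q 0 1 = (1 - conj p * p) * (1 - conj q * q) by
        rw [circNum_zero]; ring] at this
    · filter_upwards [hmem] with r hr using hb r hr.1 hr.2

end descent

section conclusion

variable {h : ℕ → ℕ → ℂ} {N : ℕ}

/-- The coefficient of `y ^ m` in a double power series. -/
noncomputable def colSeries (h : ℕ → ℕ → ℂ) (m : ℕ) (x : ℂ) : ℂ := ∑' n, h n m * x ^ n

theorem differentiableOn_colSeries (hh : BidiscSummable h) (m : ℕ) :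
    DifferentiableOn ℂ (colSeries h m) (Metric.ball 0 1) := by
  intro x hx
  obtain ⟨ρ, h1, h2⟩ := exists_between (by simpa using hx : ‖x‖ < 1)
  have h0 : 0 < ρ := (norm_nonneg x).trans_lt h1
  have hs : Summable fun n => (ρ ^ m)⁻¹ * (‖h n m‖ * ρ ^ (n + m)) :=
    ((hh ρ h0.le h2).comp_injective (i := fun n : ℕ => (n, m))
      (fun a b hab => (Prod.mk.inj hab).1)).mul_left _
  have : DifferentiableOn ℂ (colSeries h m) (Metric.ball 0 ρ) := by
    refine Complex.differentiableOn_tsum_of_summable_norm hs (fun n => by fun_prop)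
      Metric.isOpen_ball fun n w hw => ?_
    have hw' : ‖w‖ ≤ ρ := by simpa using (Metric.mem_ball.1 hw).le
    have e : (ρ ^ m)⁻¹ * (‖h n m‖ * ρ ^ (n + m)) = ‖h n m‖ * ρ ^ n := by
      rw [pow_add]; field_simp
    rw [e, norm_mul, norm_pow]
    gcongr
  exact (this.differentiableAt (Metric.isOpen_ball.mem_nhds (by simpa using h1))).differentiableWithinAt

theorem biSeries_eq_sum_colSeries (hh : BidiscSummable h) (hv : ∀ n m, N < m → h n m = 0) {x y : ℂ}
    (hx : ‖x‖ < 1) (hy : ‖y‖ < 1) :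
    biSeries h x y = ∑ m ∈ Finset.range (N + 1), colSeries h m x * y ^ m := by
  have hs := (hh.summable hx hy).prod_symm
  have h1 : biSeries h x y = ∑' m, ∑' n, h n m * x ^ n * y ^ m := by
    rw [biSeries, ← (Equiv.prodComm ℕ ℕ).tsum_eq]
    exact hs.tsum_prod
  rw [h1, tsum_eq_sum (s := Finset.range (N + 1))]
  · exact Finset.sum_congr rfl fun m _ => tsum_mul_right
  · intro m hm
    simp [hv _ m (by simpa using hm)]

/-- The polynomial in `conj z` by which `conj (discAut (-q) z) ^ m` contributes after clearing
denominators. -/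
noncomputable def conjPoly (q : ℂ) (N m : ℕ) : Polynomial ℂ :=
  (Polynomial.X - Polynomial.C (conj q)) ^ m * (1 - Polynomial.C q * Polynomial.X) ^ (N - m)

theorem natDegree_conjPoly_lt (q : ℂ) {m : ℕ} (hm : m ≤ N) :
    (conjPoly q N m).natDegree < N + 1 := by
  have h1 : (Polynomial.X - Polynomial.C (conj q)).natDegree ≤ 1 :=
    (Polynomial.natDegree_X_sub_C _).le
  have h2 : (1 - Polynomial.C q * Polynomial.X : Polynomial ℂ).natDegree ≤ 1 := by compute_degree
  have := Polynomial.natDegree_mul_le_of_le (Polynomial.natDegree_pow_le_of_le m h1)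
    (Polynomial.natDegree_pow_le_of_le (N - m) h2)
  unfold conjPoly
  omega

theorem isPolyanalytic_of_expansion {B : ℂ → ℂ} {q : ℂ} (hq : ‖q‖ < 1) (hh : BidiscSummable h)
    (hv : ∀ n m, N < m → h n m = 0)
    (hB : ∀ w : ℂ, ‖w‖ < 1 → biSeries h w (conj w) = (1 + q * conj w) ^ N * B (discAut q w)) :
    IsPolyanalyticOfOrderLE B N := by
  have hq' : ‖-q‖ < 1 := by rwa [norm_neg]
  have hκ := one_sub_norm_sq_ne_zero hq
  refine ⟨fun k z => ((1 - conj q * q) ^ N)⁻¹ * ∑ m ∈ Finset.range (N + 1),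
    (conjPoly q N m).coeff k * colSeries h m (discAut (-q) z), fun k _ => ?_, fun z hz => ?_⟩
  · refine DifferentiableOn.const_mul (DifferentiableOn.fun_sum fun m _ => ?_) _
    exact ((differentiableOn_colSeries hh m).comp (differentiableOn_discAut hq')
      (mapsTo_discAut hq')).const_mul _
  · have hz1 : ‖z‖ < 1 := by simpa using hz
    set w := discAut (-q) z with hw
    have hw1 : ‖w‖ < 1 := norm_discAut_lt_one hq' hz1
    have hwc : ‖conj w‖ < 1 := by rwa [Complex.norm_conj]
    have hne : 1 - q * conj z ≠ 0 := by
      have := one_add_mul_ne_zero hq' (by rwa [Complex.norm_conj] : ‖conj z‖ < 1)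
      simpa [sub_eq_add_neg] using this
    have e1 : (1 - q * conj z) * conj w = conj z - conj q := by
      rw [hw, conj_discAut, discAut]
      simp only [map_neg, Complex.conj_conj, neg_mul, ← sub_eq_add_neg]
      exact mul_div_cancel₀ _ hne
    have e2 : (1 - q * conj z) * (1 + q * conj w) = 1 - conj q * q := by
      linear_combination q * e1
    have e3 := hB w hw1
    rw [discAut_discAut_neg hq hz1, biSeries_eq_sum_colSeries hh hv hw1 hwc] at e3
    have e4 : (1 - conj q * q) ^ N * B z = ∑ m ∈ Finset.range (N + 1),
        colSeries h m w * (conjPoly q N m).eval (conj z) := by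
      rw [← e2, mul_pow, mul_assoc, ← e3, Finset.mul_sum]
      refine Finset.sum_congr rfl fun m hm => ?_
      have hm' : m ≤ N := by have := Finset.mem_range.1 hm; omega
      simp only [conjPoly, Polynomial.eval_mul, Polynomial.eval_pow, Polynomial.eval_sub,
        Polynomial.eval_X, Polynomial.eval_C, Polynomial.eval_one]
      rw [← e1, mul_pow]
      conv_lhs => rw [← Nat.add_sub_cancel' hm', pow_add]
      ring
    have e5 : B z = ((1 - conj q * q) ^ N)⁻¹ * ∑ m ∈ Finset.range (N + 1),
        colSeries h m w * (conjPoly q N m).eval (conj z) := by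
      rw [← e4, inv_mul_cancel_left₀ (pow_ne_zero _ hκ)]
    rw [e5]
    simp only [mul_assoc, Finset.sum_mul]
    rw [← Finset.mul_sum, Finset.sum_comm]
    congr 1
    refine Finset.sum_congr rfl fun m hm => ?_
    rw [Polynomial.eval_eq_sum_range' (natDegree_conjPoly_lt q
      (by have := Finset.mem_range.1 hm; omega : m ≤ N)), Finset.mul_sum]
    exact Finset.sum_congr rfl fun k _ => by ring

end conclusion

theorem theorem9p1 (b : ℕ → ℕ → ℂ) (B : ℂ → ℂ)
    (hseries : ∀ z ∈ Metric.ball (0 : ℂ) 1,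
      HasSum (fun p : ℕ × ℕ => b p.1 p.2 * z ^ p.1 * conj z ^ p.2) (B z))
    (hcont : ContinuousOn B (Metric.closedBall (0 : ℂ) 1))
    (ν : ℤ) (p q : ℂ) (hp : p ∈ Metric.ball (0 : ℂ) 1) (hq : q ∈ Metric.ball (0 : ℂ) 1)
    (hpq : p ≠ q) (hHp : ConditionH B p ν) (hHq : ConditionH B q ν) :
    (0 ≤ ν → IsPolyanalyticOfOrderLE B ν.toNat) ∧
      (ν ≤ 0 → DifferentiableOn ℂ B (Metric.ball (0 : ℂ) 1)) := by
  have hp1 : ‖p‖ < 1 := by simpa using hp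
  have hq1 : ‖q‖ < 1 := by simpa using hq
  obtain ⟨g, hg, hvg, hgb, hgB⟩ := hHp.exists_series hseries hp1
  obtain ⟨h, hh, hvh, hhb, hhB⟩ := hHq.exists_series hseries hq1
  obtain ⟨C, hC⟩ := (isCompact_closedBall (0 : ℂ) 1).exists_bound_of_continuousOn hcont
  have hbound : ∀ u : ℂ, ‖u‖ < 1 → ‖biSeries g u (conj u)‖ ≤ 2 ^ ν.toNat * C := by
    intro u hu
    rw [hgB u hu, norm_mul, norm_pow]
    have h1 : ‖1 + p * conj u‖ ≤ 2 := by
      refine (norm_add_le _ _).trans ?_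
      rw [norm_one, norm_mul, Complex.norm_conj]
      nlinarith [norm_nonneg p, norm_nonneg u]
    exact mul_le_mul (pow_le_pow_left₀ (norm_nonneg _) h1 _)
      (hC _ (by simpa using (norm_discAut_lt_one hp1 hu).le)) (norm_nonneg _) (by positivity)
  have hpoly : IsPolyanalyticOfOrderLE B ν.toNat :=
    isPolyanalytic_of_expansion hq1 hh
      (coeff_eq_zero_of_two_points hp1 hq1 hpq hg hh hvg hvh hgb hhb hbound) hhB
  refine ⟨fun _ => hpoly, fun hν => ?_⟩
  obtain ⟨k, hk, hkB⟩ := hpoly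
  refine (hk 0 (Nat.zero_le _)).congr fun z hz => ?_
  rw [hkB z hz, Int.toNat_of_nonpos hν]
  simp
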